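/- **Theorem (Correlator formula).** *Process.* Let $b,\sigma:\mathbb R\to\mathbb R$ be measurable and let $\ell$ be a transition kernel on $\mathbb R$ with $\ell(x,\{0\})=0$ and $\int_{\mathbb R}|z|\wedge|z|^2\,\ell(x,dz)<\infty$ for all $x$. Put $$\mathcal G f(x)=b(x)f'(x)+\tfrac12\sigma^2(x)f''(x)+\int_{\mathbb R}\big(f(x+z)-f(x)-f'(x)z\big)\,\ell(x,dz).$$ Assume that $\mathcal G$ is polynomial: $\int_{\mathbb R}|z|^k\,\ell(x,dz)<\infty$ for all $x$ and $k\ge2$, $\mathcal G0=0$, and for every $k\in\mathbb N$ the operator $\mathcal G$ maps polynomials of degree at most $k$ to polynomials of degree at most $k$. Let $Y$ be a real-valued adapted càdlàg process on a filtered probability space $(\Omega,\mathcal F,(\mathcal F_t)_{t\ge0},\mathbb P)$ with $Y(0)=y\in\mathbb R$ almost surely and with extended generator $\mathcal G$, that is, for every bounded $C^2$ function $f$ the process $f(Y(t))-f(y)-\int_0^t\mathcal Gf(Y(u))\,du$ is a local martingale. *Matrices.* Let $H_k(x)=(1,x,\dots,x^k)^\top$. Write $\otimes$ for the Kronecker product,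 $A\otimes^dB=A^{\otimes d}\otimes B$ (so $A\otimes^0B=B$), $vec$ for the stacking of the columns of a matrix, $vec^{-1}$ for its inverse, $e_{k,j}$ for the $j$-th canonical basis vector of $\mathbb R^k$ and $I_k$ for the identity matrix. For $n,r\ge0$ let $X_n^{(r)}(x)=H_n(x)^\top\otimes^rH_n(x)\in\mathbb R^{(n+1)\times(n+1)^r}$. For $a,c\ge1$ let $$E_{a,c}=\sum_{i=1}^a e_{a+c-1,i}\otimes e_{c,1}^\top\otimes e_{a,i}^\top+\sum_{i=2}^c e_{a+c-1,a+i-1}\otimes e_{c,i}^\top\otimes e_{a,a}^\top,\qquad D_{a,c}=\sum_{i=1}^a\sum_{j=1}^c e_{a+c-1,i+j-1}^\top\otimes e_{c,j}\otimes e_{a,i},$$ and let $E_{n+1}^{(0)}=D_{n+1}^{(0)}=I_{n+1}$ and, for $r\ge1$, $E_{n+1}^{(r)}=E_{nr+1,n+1}(I_{n+1}\otimes E_{n+1}^{(r-1)})$ and $D_{n+1}^{(r)}=(I_{n+1}\otimes D_{n+1}^{(r-1)})D_{nr+1,n+1}$ (so $E^{(1)}_{n+1}=E_{n+1,n+1}$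 and $D^{(1)}_{n+1}=D_{n+1,n+1}$). *Claim.* For every $k\ge0$ there is a (unique) generator matrix $G_k\in\mathbb R^{(k+1)\times(k+1)}$ with $\mathcal GH_k(x)=G_kH_k(x)$ for all $x$. Let $m,n\ge0$, let $p_0,\dots,p_m$ be real polynomials of degree at most $n$ with coefficient vectors $\vec p_0,\dots,\vec p_m\in\mathbb R^{n+1}$, and let $0\le t<s_0<s_1<\dots<s_m$. Put $\tilde G_n^{(r)}=D_{n+1}^{(r)}G_{n(r+1)}E_{n+1}^{(r)}\in\mathbb R^{(n+1)^{r+1}\times(n+1)^{r+1}}$; in particular $\tilde G_n^{(0)}=G_n$. Then $p_m(Y(s_0))\,p_{m-1}(Y(s_1))\cdots p_0(Y(s_m))$ is integrable and, almost surely, $$\mathbb E\big[p_m(Y(s_0))\,p_{m-1}(Y(s_1))\cdots p_0(Y(s_m))\,\big|\,\mathcal F_t\big]=\vec p_m^{\,\top}\Big\{vec^{-1}\circ e^{\tilde G_n^{(m)}(s_0-t)}\circ vec\big(X_n^{(m)}(Y(t))\big)\Big\}\prod_{k=1}^m e^{\tilde G_n^{(m-k)\top}(s_k-s_{k-1})}\big\{I_{n+1}\otimes^{m-k}\vec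 p_{m-k}\big\},$$ where the factors of the product are ordered from left to right by increasing $k$. Moreover, for all $r\ge0$ and $\tau,x\in\mathbb R$, $$e^{\tilde G_n^{(r)}\tau}\,vec\big(X_n^{(r)}(x)\big)=D_{n+1}^{(r)}e^{G_{n(r+1)}\tau}E_{n+1}^{(r)}\,vec\big(X_n^{(r)}(x)\big),\qquad e^{\tilde G_n^{(r)}\tau}=D_{n+1}^{(r)}e^{G_{n(r+1)}\tau}E_{n+1}^{(r)}+\big(I_{(n+1)^{r+1}}-D_{n+1}^{(r)}E_{n+1}^{(r)}\big),$$ and the correlator formula remains valid if every $e^{\tilde G_n^{(r)}\tau}$ in it is replaced by $D_{n+1}^{(r)}e^{G_{n(r+1)}\tau}E_{n+1}^{(r)}$ (and every $e^{\tilde G_n^{(r)\top}\tau}$ by the transpose of that matrix). -/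

import Mathlib

open MeasureTheory ProbabilityTheory Filter Topology
open scoped NNReal Polynomial Matrix Kronecker

namespace PolyCorr

noncomputable section

/-! ### Polynomial jump-diffusions -/

/-- The jump-diffusion operator
`𝒢 f(x) = b(x) f'(x) + ½ σ²(x) f''(x) + ∫ (f(x+z) - f(x) - f'(x) z) ℓ(x,dz)`. -/
def generator (b σ : ℝ → ℝ) (ℓ : Kernel ℝ ℝ) (f : ℝ → ℝ) (x : ℝ) : ℝ :=
  b x * deriv f x + 1 / 2 * (σ x) ^ 2 * deriv (deriv f) x
    + ∫ z, (f (x + z) - f x - deriv f x * z) ∂(ℓ x)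

/-- Conditions on the coefficients of a jump-diffusion operator: `b`, `σ` are measurable,
`ℓ(x,{0}) = 0` and `∫ |z| ∧ |z|² ℓ(x,dz) < ∞` for all `x`. -/
structure IsJumpDiffusionOperator (b σ : ℝ → ℝ) (ℓ : Kernel ℝ ℝ) : Prop where
  measurable_b : Measurable b
  measurable_σ : Measurable σ
  no_zero_jump : ∀ x, ℓ x {0} = 0
  integrable_min : ∀ x, Integrable (fun z : ℝ => min |z| (|z| ^ 2)) (ℓ x)

/-- The operator is polynomial: all jump moments of order at least two are finite, it annihilates
the zero function, and it maps polynomials of degree `≤ k` to polynomials of degree `≤ k`,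
for every `k`. -/
structure IsPolynomialOperator (b σ : ℝ → ℝ) (ℓ : Kernel ℝ ℝ) : Prop where
  integrable_pow : ∀ x, ∀ k : ℕ, 2 ≤ k → Integrable (fun z : ℝ => |z| ^ k) (ℓ x)
  map_zero : ∀ x, generator b σ ℓ (fun _ => 0) x = 0
  map_degree_le : ∀ k : ℕ, ∀ p : ℝ[X], p.natDegree ≤ k →
    ∃ q : ℝ[X], q.natDegree ≤ k ∧ ∀ x, generator b σ ℓ (fun u => p.eval u) x = q.eval x

/-- `M` is a local martingale. -/
def IsLocalMartingale {Ω : Type*} {mΩ : MeasurableSpace Ω} (M : ℝ≥0 → Ω → ℝ)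
    (𝓕 : Filtration ℝ≥0 mΩ) (P : Measure Ω) : Prop :=
  Locally (fun N => Martingale N 𝓕 P) 𝓕 M P

/-- `Y` is a jump-diffusion started at `y` with extended generator `𝒢`: an adapted càdlàg process
with `Y(0) = y` almost surely such that, for every bounded `C²` function `f`, the process
`f(Y(t)) - f(y) - ∫₀ᵗ 𝒢 f(Y(u)) du` is a local martingale. -/
structure IsJumpDiffusion {Ω : Type*} {mΩ : MeasurableSpace Ω} (b σ : ℝ → ℝ) (ℓ : Kernel ℝ ℝ)
    (𝓕 : Filtration ℝ≥0 mΩ) (P : Measure Ω) (y : ℝ) (Y : ℝ≥0 → Ω → ℝ) : Prop where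
  adapted : StronglyAdapted 𝓕 Y
  right_continuous : ∀ ω t, ContinuousWithinAt (fun u => Y u ω) (Set.Ici t) t
  left_limits : ∀ ω t, ∃ l : ℝ, Tendsto (fun u => Y u ω) (𝓝[<] t) (𝓝 l)
  initial : ∀ᵐ ω ∂P, Y 0 ω = y
  martingale_problem : ∀ f : ℝ → ℝ, ContDiff ℝ 2 f → (∃ C, ∀ x, |f x| ≤ C) →
    IsLocalMartingale
      (fun t ω => f (Y t ω) - f y
        - ∫ u in (0 : ℝ)..t, generator b σ ℓ f (Y u.toNNReal ω)) 𝓕 P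

/-! ### Matrix operations

All matrices have index sets `Fin a`, so they are honest elements of `ℝ^{a × b}`; the bijection
`finProdFinEquiv : Fin a × Fin c ≃ Fin (a * c)` is the lexicographic one, `(i, j) ↦ c * i + j`. -/

/-- Change of the description of the dimensions of a matrix. -/
def mcast {a b a' b' : ℕ} (ha : a = a') (hb : b = b') (A : Matrix (Fin a) (Fin b) ℝ) :
    Matrix (Fin a') (Fin b') ℝ :=
  A.submatrix (Fin.cast ha.symm) (Fin.cast hb.symm)

/-- Kronecker product of an `a × b` and a `c × d` matrix, as an `ac × bd` matrix. -/
def kron {a b c d : ℕ} (A : Matrix (Fin a) (Fin b) ℝ) (B : Matrix (Fin c) (Fin d) ℝ) :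
    Matrix (Fin (a * c)) (Fin (b * d)) ℝ :=
  Matrix.reindex finProdFinEquiv finProdFinEquiv (A ⊗ₖ B)

/-- Kronecker power `A^{⊗ d}`. -/
def kronPow {a b : ℕ} (A : Matrix (Fin a) (Fin b) ℝ) :
    (d : ℕ) → Matrix (Fin (a ^ d)) (Fin (b ^ d)) ℝ
  | 0 => mcast (pow_zero a).symm (pow_zero b).symm 1
  | d + 1 => mcast (pow_succ' a d).symm (pow_succ' b d).symm (kron A (kronPow A d))

/-- The `d`-Kronecker product `A ⊗^d B = A^{⊗ d} ⊗ B`, which is `B` for `d = 0`. -/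
def dKron {a b c e : ℕ} (d : ℕ) (A : Matrix (Fin a) (Fin b) ℝ) (B : Matrix (Fin c) (Fin e) ℝ) :
    Matrix (Fin (a ^ d * c)) (Fin (b ^ d * e)) ℝ :=
  kron (kronPow A d) B

/-- Vectorization of an `a × b` matrix: its columns stacked into one vector of length `N = ba`. -/
def vec {a b N : ℕ} (h : N = b * a) (A : Matrix (Fin a) (Fin b) ℝ) : Fin N → ℝ :=
  fun k => A.vec (finProdFinEquiv.symm (Fin.cast h k))

/-- Inverse vectorization: `[vec⁻¹ v]_{i,j} = v_{a j + i}` (indices from `0`). -/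
def vecInv {a b N : ℕ} (h : N = b * a) (v : Fin N → ℝ) : Matrix (Fin a) (Fin b) ℝ :=
  Matrix.of fun i j => v (Fin.cast h.symm (finProdFinEquiv (j, i)))

/-! ### Monomial basis and generator matrix -/

/-- `H_k(x) = (1, x, …, x^k)ᵀ` as a column. -/
def monomials (k : ℕ) (x : ℝ) : Matrix (Fin (k + 1)) (Fin 1) ℝ :=
  Matrix.of fun i _ => x ^ (i : ℕ)

/-- Column of the coefficients of `p` with respect to `1, x, …, x^n`. -/
def coeffCol (n : ℕ) (p : ℝ[X]) : Matrix (Fin (n + 1)) (Fin 1) ℝ :=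
  Matrix.of fun i _ => p.coeff i

/-- `𝒢 H_k(x) = M H_k(x)` for all `x`, where `𝒢` acts on each entry. -/
def IsGeneratorMatrix (b σ : ℝ → ℝ) (ℓ : Kernel ℝ ℝ) (k : ℕ)
    (M : Matrix (Fin (k + 1)) (Fin (k + 1)) ℝ) : Prop :=
  ∀ x : ℝ, (Matrix.of fun (i : Fin (k + 1)) (_ : Fin 1) =>
    generator b σ ℓ (fun u => u ^ (i : ℕ)) x) = M * monomials k x

open Classical in
/-- The generator matrix `G_k` of order `k`: the matrix with `𝒢 H_k = G_k H_k`. There is at most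
one, by linear independence of the monomials, and there is one when `𝒢` is polynomial. -/
def generatorMatrix (b σ : ℝ → ℝ) (ℓ : Kernel ℝ ℝ) (k : ℕ) :
    Matrix (Fin (k + 1)) (Fin (k + 1)) ℝ :=
  if h : ∃ M, IsGeneratorMatrix b σ ℓ k M then h.choose else 0

/-! ### Eliminating and duplicating matrices -/

/-- The L-eliminating matrix `E_{a+1,b+1}`, which maps `vec A` to the first column of `A` followed
by the last row of `A` without its first entry, for `A` of size `(a+1) × (b+1)`.
`Matrix.single k (finProdFinEquiv (j, i)) 1` is `e_k ⊗ e_jᵀ ⊗ e_iᵀ`. -/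
def lElim (a b : ℕ) : Matrix (Fin (a + b + 1)) (Fin ((b + 1) * (a + 1))) ℝ :=
  (∑ i : Fin (a + 1), Matrix.single (⟨i, by omega⟩ : Fin (a + b + 1))
      (finProdFinEquiv ((0 : Fin (b + 1)), i)) (1 : ℝ))
    + ∑ j : Fin b, Matrix.single (⟨a + 1 + j, by omega⟩ : Fin (a + b + 1))
      (finProdFinEquiv (j.succ, Fin.last a)) (1 : ℝ)

/-- The L-duplicating matrix `D_{a+1,b+1}`. -/
def lDup (a b : ℕ) : Matrix (Fin ((b + 1) * (a + 1))) (Fin (a + b + 1)) ℝ :=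
  ∑ i : Fin (a + 1), ∑ j : Fin (b + 1),
    Matrix.single (finProdFinEquiv (j, i)) (⟨i + j, by omega⟩ : Fin (a + b + 1)) (1 : ℝ)

/-- The `r`-th L-eliminating matrix `E_{n+1}^{(r)}`. For `r = 0` it is the identity, and
`E^{(r+1)} = E_{n(r+1)+1,n+1} (I_{n+1} ⊗ E^{(r)})`; in particular `E^{(1)} = E_{n+1,n+1}`. -/
def elimMatrix (n : ℕ) :
    (r : ℕ) → Matrix (Fin (n * (r + 1) + 1)) (Fin ((n + 1) ^ (r + 1))) ℝ
  | 0 => mcast (a := n + 1) (b := n + 1) (by simp) (by simp) 1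
  | r + 1 => mcast rfl (pow_succ' (n + 1) (r + 1)).symm
      (lElim (n * (r + 1)) n * kron (1 : Matrix (Fin (n + 1)) (Fin (n + 1)) ℝ) (elimMatrix n r))

/-- The `r`-th L-duplicating matrix `D_{n+1}^{(r)}`. For `r = 0` it is the identity, and
`D^{(r+1)} = (I_{n+1} ⊗ D^{(r)}) D_{n(r+1)+1,n+1}`; in particular `D^{(1)} = D_{n+1,n+1}`. -/
def dupMatrix (n : ℕ) :
    (r : ℕ) → Matrix (Fin ((n + 1) ^ (r + 1))) (Fin (n * (r + 1) + 1)) ℝ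
  | 0 => mcast (a := n + 1) (b := n + 1) (by simp) (by simp) 1
  | r + 1 => mcast (pow_succ' (n + 1) (r + 1)).symm rfl
      (kron (1 : Matrix (Fin (n + 1)) (Fin (n + 1)) ℝ) (dupMatrix n r) * lDup (n * (r + 1)) n)

/-! ### The correlator formula -/

/-- `X_n^{(r)}(x) = H_n(x)ᵀ ⊗^r H_n(x)`, of size `(n+1) × (n+1)^r`. -/
def powMatrix (n r : ℕ) (x : ℝ) : Matrix (Fin (n + 1)) (Fin ((n + 1) ^ r)) ℝ :=
  mcast (by simp) (by simp) (dKron r (monomials n x)ᵀ (monomials n x))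

/-- `vec (X_n^{(r)}(x))`, of length `(n+1)^{r+1}`. -/
def vecPow (n r : ℕ) (x : ℝ) : Fin ((n + 1) ^ (r + 1)) → ℝ :=
  vec (pow_succ (n + 1) r) (powMatrix n r x)

/-- `I_{n+1} ⊗^r p`, with `p` identified with its column of coefficients,
of size `(n+1)^{r+1} × (n+1)^r`. -/
def idKronCoeff (n r : ℕ) (p : ℝ[X]) : Matrix (Fin ((n + 1) ^ (r + 1))) (Fin ((n + 1) ^ r)) ℝ :=
  mcast (pow_succ (n + 1) r).symm (by simp)
    (dKron r (1 : Matrix (Fin (n + 1)) (Fin (n + 1)) ℝ) (coeffCol n p))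

/-- `G̃_n^{(r)} = D_{n+1}^{(r)} G_{n(r+1)} E_{n+1}^{(r)}`. -/
def corrGenerator (b σ : ℝ → ℝ) (ℓ : Kernel ℝ ℝ) (n r : ℕ) :
    Matrix (Fin ((n + 1) ^ (r + 1))) (Fin ((n + 1) ^ (r + 1))) ℝ :=
  dupMatrix n r * generatorMatrix b σ ℓ (n * (r + 1)) * elimMatrix n r

/-- `e^{G̃_n^{(r)} τ}`. -/
def corrExp (b σ : ℝ → ℝ) (ℓ : Kernel ℝ ℝ) (n r : ℕ) (τ : ℝ) :
    Matrix (Fin ((n + 1) ^ (r + 1))) (Fin ((n + 1) ^ (r + 1))) ℝ :=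
  NormedSpace.exp (τ • corrGenerator b σ ℓ n r)

/-- `D_{n+1}^{(r)} e^{G_{n(r+1)} τ} E_{n+1}^{(r)}`. -/
def dupExpElim (b σ : ℝ → ℝ) (ℓ : Kernel ℝ ℝ) (n r : ℕ) (τ : ℝ) :
    Matrix (Fin ((n + 1) ^ (r + 1))) (Fin ((n + 1) ^ (r + 1))) ℝ :=
  dupMatrix n r * NormedSpace.exp (τ • generatorMatrix b σ ℓ (n * (r + 1))) * elimMatrix n r

/-- The ordered product `F (m-1) * F (m-2) * ⋯ * F 0`, where `F j` has size
`(n+1)^{j+1} × (n+1)^j`. -/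
def descProd (n : ℕ) (F : (j : ℕ) → Matrix (Fin ((n + 1) ^ (j + 1))) (Fin ((n + 1) ^ j)) ℝ) :
    (m : ℕ) → Matrix (Fin ((n + 1) ^ m)) (Fin ((n + 1) ^ 0)) ℝ
  | 0 => 1
  | m + 1 => F m * descProd n F m

/-- The `1 × 1` matrix
`p_mᵀ {vec⁻¹ ∘ M^{(m)}(s_0 - t) ∘ vec (X_n^{(m)}(x))}
  ∏_{k=1}^m M^{(m-k)}(s_k - s_{k-1})ᵀ {I_{n+1} ⊗^{m-k} p_{m-k}}`
for a family `M^{(r)}(τ)`, to be taken as `e^{G̃^{(r)} τ}`. The factor of index `k` in the product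
is the factor of index `j = m - k` in `descProd`. -/
def corrFormula (n m : ℕ) (p : ℕ → ℝ[X]) (t : ℝ≥0) (s : ℕ → ℝ≥0)
    (M : (r : ℕ) → ℝ → Matrix (Fin ((n + 1) ^ (r + 1))) (Fin ((n + 1) ^ (r + 1))) ℝ) (x : ℝ) :
    Matrix (Fin 1) (Fin ((n + 1) ^ 0)) ℝ :=
  (coeffCol n (p m))ᵀ
    * vecInv (pow_succ (n + 1) m) (M m ((s 0 : ℝ) - t) *ᵥ vecPow n m x)
    * descProd n (fun j => (M j ((s (m - j) : ℝ) - s (m - j - 1)))ᵀ * idKronCoeff n j (p j)) m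

end

end PolyCorr

open PolyCorr

/-!
Algebra: `E` is a left inverse of `D`, so `(D G E)^k = D G^k E` for `k ≥ 1`, whence
`e^{D G E τ} = D e^{G τ} E + (1 - D E)`. Moreover `D H_{n(r+1)}(x) = vec (X_n^{(r)}(x))`, so that
`1 - D E` vanishes on `vec (X_n^{(r)}(x))`.

Moments: every power of `1 + x²` is a nonnegative polynomial `V` with `𝒢 V ≤ C V`. The bounded
functions `V / (1 + ε V)` satisfy the same inequality because `v ↦ v / (1 + ε v)` is concave, so
Grönwall's inequality and Fatou's lemma as `ε → 0` bound the moments of `Y`. With these bounds,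
Dynkin's formula extends from bounded functions to polynomials `q`, as the limit of the formulas
for `q (ε⁻¹ sin (ε x))`. For `A ∈ 𝓕_s`, the integrals of `H_k(Y(t))` over `A` therefore solve the
linear equation `m' = G_k m`, which is the moment formula
`E[H_k(Y(t)) | 𝓕_s] = e^{G_k (t - s)} H_k(Y(s))`.

Correlators: starting from the last time point and using the tower property, each step applies
the moment formula to a linear functional of `vec (X_n^{(r)}(Y))`, and multiplication by `p(Y)`
turns a functional of `vec (X_n^{(r)})` into one of `vec (X_n^{(r+1)})`, with matrix `I ⊗^{r+1} p`.
-/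

namespace PolyCorr

noncomputable section

/-! ### Kronecker products and tensor powers of the monomials -/

/-- `H_k(x)` as a vector, the form on which matrices act by `*ᵥ`. -/
def monomialVec (k : ℕ) (x : ℝ) : Fin (k + 1) → ℝ := fun i => x ^ (i : ℕ)

/-- Index of `Fin ((n+1)^(r+1))` with leading digit `i` and remaining digits `j` in base `n+1`. -/
def consIdx {n r : ℕ} (i : Fin (n + 1)) (j : Fin ((n + 1) ^ r)) : Fin ((n + 1) ^ (r + 1)) :=
  Fin.cast (pow_succ' (n + 1) r).symm (finProdFinEquiv (i, j))

/-- Index of `Fin ((n+1)^(r+1))` with leading digits `j` and last digit `i` in base `n+1`. -/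
def snocIdx {n r : ℕ} (j : Fin ((n + 1) ^ r)) (i : Fin (n + 1)) : Fin ((n + 1) ^ (r + 1)) :=
  Fin.cast (pow_succ (n + 1) r).symm (finProdFinEquiv (j, i))

/-- The entries of the Kronecker power `H_n(x)^{⊗ r}`. -/
def tensorMonomials (n r : ℕ) (x : ℝ) (k : Fin ((n + 1) ^ r)) : ℝ :=
  kronPow (monomials n x)ᵀ r ⟨0, by simp⟩ k

section Kronecker

variable {a b c d e f a' b' c' : ℕ}

lemma kron_apply (A : Matrix (Fin a) (Fin b) ℝ) (B : Matrix (Fin c) (Fin d) ℝ)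
    (i : Fin a) (j : Fin c) (k : Fin b) (l : Fin d) :
    kron A B (finProdFinEquiv (i, j)) (finProdFinEquiv (k, l)) = A i k * B j l := by
  simp [kron]

lemma kron_mul_kron (A : Matrix (Fin a) (Fin b) ℝ) (B : Matrix (Fin c) (Fin d) ℝ)
    (A' : Matrix (Fin b) (Fin e) ℝ) (B' : Matrix (Fin d) (Fin f) ℝ) :
    kron A B * kron A' B' = kron (A * A') (B * B') := by
  simp only [kron, Matrix.reindex_apply, Matrix.submatrix_mul_equiv, ← Matrix.mul_kronecker_mul]

lemma kron_one_one (a b : ℕ) :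
    kron (1 : Matrix (Fin a) (Fin a) ℝ) (1 : Matrix (Fin b) (Fin b) ℝ) = 1 := by
  simp [kron]

lemma kron_mulVec (A : Matrix (Fin a) (Fin b) ℝ) (B : Matrix (Fin c) (Fin d) ℝ)
    (u : Fin b → ℝ) (w : Fin d → ℝ) (v : Fin (b * d) → ℝ)
    (hv : ∀ k l, v (finProdFinEquiv (k, l)) = u k * w l) (i : Fin a) (j : Fin c) :
    (kron A B *ᵥ v) (finProdFinEquiv (i, j)) = (A *ᵥ u) i * (B *ᵥ w) j := by
  simp only [Matrix.mulVec, dotProduct]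
  rw [← Equiv.sum_comp finProdFinEquiv, Fintype.sum_prod_type, Finset.sum_mul_sum]
  refine Finset.sum_congr rfl fun k _ => Finset.sum_congr rfl fun l _ => ?_
  rw [kron_apply, hv]; ring

lemma mcast_mul_mcast (ha : a = a') (hb : b = b') (hc : c = c')
    (A : Matrix (Fin a) (Fin b) ℝ) (B : Matrix (Fin b) (Fin c) ℝ) :
    mcast ha hb A * mcast hb hc B = mcast ha hc (A * B) := by
  subst ha hb hc; rfl

lemma mcast_one (ha ha' : a = a') : mcast ha ha' (1 : Matrix (Fin a) (Fin a) ℝ) = 1 := by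
  subst ha; rfl

lemma mcast_mulVec (ha : a = a') (hb : b = b') (A : Matrix (Fin a) (Fin b) ℝ) (v : Fin b' → ℝ)
    (k : Fin a') :
    (mcast ha hb A *ᵥ v) k = (A *ᵥ (fun i => v (Fin.cast hb i))) (Fin.cast ha.symm k) := by
  subst ha hb; rfl

lemma kronPow_one (a r : ℕ) : kronPow (1 : Matrix (Fin a) (Fin a) ℝ) r = 1 := by
  induction r with
  | zero => exact mcast_one _ _
  | succ r ih => rw [kronPow, ih, kron_one_one, mcast_one]

end Kronecker

section Digits

variable {n r : ℕ}

lemma consIdx_val (i : Fin (n + 1)) (j : Fin ((n + 1) ^ r)) :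
    (consIdx i j : ℕ) = j + (n + 1) ^ r * i := by
  simp [consIdx, finProdFinEquiv_apply_val]

lemma snocIdx_val (j : Fin ((n + 1) ^ r)) (i : Fin (n + 1)) :
    (snocIdx j i : ℕ) = i + (n + 1) * j := by
  simp [snocIdx, finProdFinEquiv_apply_val]

lemma exists_eq_consIdx (k : Fin ((n + 1) ^ (r + 1))) :
    ∃ (i : Fin (n + 1)) (j : Fin ((n + 1) ^ r)), k = consIdx i j := by
  obtain ⟨⟨i, j⟩, h⟩ := finProdFinEquiv.surjective (Fin.cast (pow_succ' (n + 1) r) k)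
  exact ⟨i, j, by rw [consIdx, h]; rfl⟩

lemma exists_eq_snocIdx (k : Fin ((n + 1) ^ (r + 1))) :
    ∃ (j : Fin ((n + 1) ^ r)) (i : Fin (n + 1)), k = snocIdx j i := by
  obtain ⟨⟨j, i⟩, h⟩ := finProdFinEquiv.surjective (Fin.cast (pow_succ (n + 1) r) k)
  exact ⟨j, i, by rw [snocIdx, h]; rfl⟩

lemma snocIdx_consIdx (i : Fin (n + 1)) (j : Fin ((n + 1) ^ r)) (k : Fin (n + 1)) :
    snocIdx (consIdx i j) k = consIdx i (snocIdx j k) := by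
  ext
  simp only [snocIdx_val, consIdx_val]
  ring

lemma snocIdx_eq_consIdx (j : Fin ((n + 1) ^ 0)) (i : Fin (n + 1)) :
    snocIdx j i = consIdx i j := by
  have hj : (j : ℕ) = 0 := by simpa only [pow_zero, Nat.lt_one_iff] using j.isLt
  ext
  rw [snocIdx_val, consIdx_val, hj, pow_zero]
  ring

lemma sum_snocIdx {M : Type*} [AddCommMonoid M] (f : Fin ((n + 1) ^ (r + 1)) → M) :
    ∑ k, f k = ∑ j : Fin ((n + 1) ^ r), ∑ i : Fin (n + 1), f (snocIdx j i) := by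
  rw [← Fintype.sum_prod_type' (f := fun j i => f (snocIdx j i))]
  exact (Equiv.sum_comp (finProdFinEquiv.trans (finCongr (pow_succ (n + 1) r).symm)) f).symm

end Digits

lemma tensorMonomials_zero (n : ℕ) (x : ℝ) (k : Fin ((n + 1) ^ 0)) :
    tensorMonomials n 0 x k = 1 := by
  have hk : k = ⟨0, by simp⟩ :=
    Fin.ext (by simpa only [pow_zero, Nat.lt_one_iff] using k.isLt)
  subst hk
  exact Matrix.one_apply_eq _

lemma tensorMonomials_consIdx (n r : ℕ) (x : ℝ) (i : Fin (n + 1)) (j : Fin ((n + 1) ^ r)) :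
    tensorMonomials n (r + 1) x (consIdx i j) = x ^ (i : ℕ) * tensorMonomials n r x j := by
  have h0 : Fin.cast (pow_succ' 1 r) (⟨0, by simp⟩ : Fin (1 ^ (r + 1))) =
      finProdFinEquiv ((0 : Fin 1), (⟨0, by simp⟩ : Fin (1 ^ r))) := by
    ext; simp
  calc tensorMonomials n (r + 1) x (consIdx i j)
      = kron (monomials n x)ᵀ (kronPow (monomials n x)ᵀ r)
          (Fin.cast (pow_succ' 1 r) ⟨0, by simp⟩) (finProdFinEquiv (i, j)) := rfl
    _ = x ^ (i : ℕ) * tensorMonomials n r x j := by rw [h0, kron_apply]; rfl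

lemma vecPow_snocIdx (n r : ℕ) (x : ℝ) (j : Fin ((n + 1) ^ r)) (i : Fin (n + 1)) :
    vecPow n r x (snocIdx j i) = tensorMonomials n r x j * x ^ (i : ℕ) := by
  have h1 : (Fin.cast (by simp) i : Fin (1 ^ r * (n + 1))) =
      finProdFinEquiv ((⟨0, by simp⟩ : Fin (1 ^ r)), i) := by
    ext; simp
  have h2 : (Fin.cast (by simp) j : Fin ((n + 1) ^ r * 1)) =
      finProdFinEquiv (j, (0 : Fin 1)) := by
    ext; simp
  simp only [vecPow, vec, snocIdx, Fin.cast_cast, Fin.cast_refl, Equiv.symm_apply_apply,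
    Matrix.vec, powMatrix, mcast, Matrix.submatrix_apply, dKron, id]
  rw [h1, h2, kron_apply]
  rfl

/-- Peeling off the first and the last digit of the index are interchangeable because the Kronecker
product is associative. -/
lemma vecPow_eq_tensorMonomials (n r : ℕ) (x : ℝ) :
    vecPow n r x = tensorMonomials n (r + 1) x := by
  induction r with
  | zero =>
    ext k
    obtain ⟨j, i, rfl⟩ := exists_eq_snocIdx k
    rw [vecPow_snocIdx, snocIdx_eq_consIdx, tensorMonomials_consIdx, mul_comm]
  | succ r ih =>
    ext k
    obtain ⟨j, i, rfl⟩ := exists_eq_snocIdx k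
    obtain ⟨l, j, rfl⟩ := exists_eq_consIdx j
    rw [vecPow_snocIdx, snocIdx_consIdx, tensorMonomials_consIdx, tensorMonomials_consIdx, ← ih,
      vecPow_snocIdx, mul_assoc]

lemma tensorMonomials_snocIdx (n r : ℕ) (x : ℝ) (j : Fin ((n + 1) ^ r)) (i : Fin (n + 1)) :
    tensorMonomials n (r + 1) x (snocIdx j i) = tensorMonomials n r x j * x ^ (i : ℕ) := by
  rw [← vecPow_eq_tensorMonomials, vecPow_snocIdx]

/-! ### Elimination and duplication -/

lemma lElim_mulVec_of_le (a b : ℕ) (v : Fin ((b + 1) * (a + 1)) → ℝ) (k : Fin (a + b + 1))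
    (hk : (k : ℕ) ≤ a) : (lElim a b *ᵥ v) k = v (finProdFinEquiv (0, ⟨k, by omega⟩)) := by
  simp only [lElim, Matrix.add_mulVec, Matrix.sum_mulVec, Pi.add_apply, Finset.sum_apply,
    Matrix.single_mulVec, one_mul, Function.update_apply, Pi.zero_apply, Fin.ext_iff]
  rw [Finset.sum_eq_single ⟨k, by omega⟩
    (fun i _ hi => if_neg fun h => hi (Fin.ext h.symm)) (by simp),
    Finset.sum_eq_zero fun j _ => if_neg (by omega)]
  simp

lemma lElim_mulVec_of_lt (a b : ℕ) (v : Fin ((b + 1) * (a + 1)) → ℝ) (k : Fin (a + b + 1))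
    (hk : a < k) : (lElim a b *ᵥ v) k = v (finProdFinEquiv (⟨k - a, by omega⟩, Fin.last a)) := by
  simp only [lElim, Matrix.add_mulVec, Matrix.sum_mulVec, Pi.add_apply, Finset.sum_apply,
    Matrix.single_mulVec, one_mul, Function.update_apply, Pi.zero_apply, Fin.ext_iff]
  rw [Finset.sum_eq_zero fun i _ => if_neg (by omega),
    Finset.sum_eq_single ⟨k - a - 1, by omega⟩
      (fun j _ hj => if_neg fun h => hj (Fin.ext (by dsimp only; omega))) (by simp),
    if_pos (by dsimp only; omega), zero_add]
  congr 3
  ext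
  simp only [Fin.succ_mk]
  omega

lemma lDup_mulVec (a b : ℕ) (v : Fin (a + b + 1) → ℝ) (j : Fin (b + 1)) (i : Fin (a + 1)) :
    (lDup a b *ᵥ v) (finProdFinEquiv (j, i)) = v ⟨i + j, by omega⟩ := by
  simp only [lDup, Matrix.sum_mulVec, Finset.sum_apply, Matrix.single_mulVec, one_mul,
    Function.update_apply, Pi.zero_apply, EmbeddingLike.apply_eq_iff_eq, Prod.mk.injEq]
  rw [Finset.sum_eq_single i, Finset.sum_eq_single j]
  · simp
  · exact fun j' _ hj => if_neg fun h => hj h.1.symm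
  · simp
  · exact fun i' _ hi => Finset.sum_eq_zero fun j' _ => if_neg fun h => hi h.2.symm
  · simp

lemma lElim_mul_lDup (a b : ℕ) : lElim a b * lDup a b = 1 := by
  refine Matrix.ext_of_mulVec_single fun c => funext fun k => ?_
  rw [← Matrix.mulVec_mulVec, Matrix.one_mulVec]
  by_cases hk : (k : ℕ) ≤ a
  · rw [lElim_mulVec_of_le a b _ k hk, lDup_mulVec]
    rfl
  · rw [lElim_mulVec_of_lt a b _ k (by omega), lDup_mulVec]
    congr 1
    ext
    simp only [Fin.val_last]
    omega

lemma elimMatrix_mul_dupMatrix (n r : ℕ) : elimMatrix n r * dupMatrix n r = 1 := by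
  induction r with
  | zero => rw [elimMatrix, dupMatrix, mcast_mul_mcast, one_mul, mcast_one]
  | succ r ih =>
    rw [elimMatrix, dupMatrix, mcast_mul_mcast, Matrix.mul_assoc, ← Matrix.mul_assoc (kron _ _),
      kron_mul_kron, ih, one_mul, kron_one_one, Matrix.one_mul, lElim_mul_lDup]
    rfl

lemma dupMatrix_mulVec (n r : ℕ) (x : ℝ) :
    dupMatrix n r *ᵥ monomialVec (n * (r + 1)) x = tensorMonomials n (r + 1) x := by
  induction r with
  | zero =>
    ext k
    obtain ⟨j, i, rfl⟩ := exists_eq_snocIdx k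
    have hj : (j : ℕ) = 0 := by simpa only [pow_zero, Nat.lt_one_iff] using j.isLt
    rw [dupMatrix, mcast_mulVec, tensorMonomials_snocIdx, tensorMonomials_zero, Matrix.one_mulVec]
    simp [monomialVec, snocIdx_val, hj]
  | succ r ih =>
    ext k
    obtain ⟨i, j, rfl⟩ := exists_eq_consIdx k
    have hij : Fin.cast (pow_succ' (n + 1) (r + 1)) (consIdx i j) = finProdFinEquiv (i, j) := rfl
    have hprod (k l) : (lDup (n * (r + 1)) n *ᵥ monomialVec (n * (r + 1) + n) x)
        (finProdFinEquiv (k, l)) = monomialVec n x k * monomialVec (n * (r + 1)) x l := by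
      rw [lDup_mulVec, monomialVec, monomialVec, monomialVec, pow_add, mul_comm]
    calc (dupMatrix n (r + 1) *ᵥ monomialVec (n * (r + 1 + 1)) x) (consIdx i j)
        = (kron 1 (dupMatrix n r) *ᵥ (lDup (n * (r + 1)) n *ᵥ monomialVec (n * (r + 1) + n) x))
            (finProdFinEquiv (i, j)) := by
          rw [dupMatrix, mcast_mulVec, hij, ← Matrix.mulVec_mulVec]; rfl
      _ = tensorMonomials n (r + 1 + 1) x (consIdx i j) := by
          rw [kron_mulVec _ _ _ _ _ hprod, ih, tensorMonomials_consIdx, Matrix.one_mulVec]; rfl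

lemma elimMatrix_mulVec (n r : ℕ) (x : ℝ) :
    elimMatrix n r *ᵥ tensorMonomials n (r + 1) x = monomialVec (n * (r + 1)) x := by
  rw [← dupMatrix_mulVec, Matrix.mulVec_mulVec, elimMatrix_mul_dupMatrix, Matrix.one_mulVec]

section LeftInverse

variable {ι κ : Type*} [Fintype ι] [DecidableEq ι] [Fintype κ] [DecidableEq κ]

lemma pow_mul_mul_of_mul_eq_one {R : Type*} [Semiring R] {D : Matrix κ ι R} {E : Matrix ι κ R}
    (hED : E * D = 1) (G : Matrix ι ι R) (k : ℕ) :
    (D * G * E) ^ (k + 1) = D * G ^ (k + 1) * E := by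
  induction k with
  | zero => simp only [zero_add, pow_one]
  | succ k ih =>
    calc (D * G * E) ^ (k + 1 + 1)
        = D * G ^ (k + 1) * (E * D) * G * E := by rw [pow_succ, ih]; simp only [Matrix.mul_assoc]
      _ = D * G ^ (k + 1 + 1) * E := by
          rw [hED, Matrix.mul_one, Matrix.mul_assoc D, ← pow_succ]

open scoped Matrix.Norms.Operator in
/-- Only the constant term of the exponential series sees that `D * E` need not be `1`. -/
lemma exp_mul_mul_of_mul_eq_one {𝕂 : Type*} [RCLike 𝕂] {D : Matrix κ ι 𝕂} {E : Matrix ι κ 𝕂}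
    (hED : E * D = 1) (G : Matrix ι ι 𝕂) :
    NormedSpace.exp (D * G * E) = D * NormedSpace.exp G * E + (1 - D * E) := by
  let φ : Matrix ι ι 𝕂 →+ Matrix κ κ 𝕂 :=
    { toFun := fun M => D * M * E
      map_zero' := by simp
      map_add' := fun A B => by simp [Matrix.mul_add, Matrix.add_mul] }
  have hφ : Continuous φ :=
    (continuous_const.matrix_mul continuous_id).matrix_mul continuous_const
  have hsum := ((NormedSpace.exp_series_hasSum_exp' (𝕂 := 𝕂) G).map φ hφ).add
    (hasSum_ite_eq (0 : ℕ) (1 - D * E))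
  refine (NormedSpace.exp_series_hasSum_exp' (𝕂 := 𝕂) (D * G * E)).unique (hsum.congr_fun ?_)
  rintro (_ | k)
  · simp [φ]
  · simp [φ, pow_mul_mul_of_mul_eq_one hED]

end LeftInverse

section CorrelatorMatrices

variable (b σ : ℝ → ℝ) (ℓ : Kernel ℝ ℝ) (n r : ℕ)

lemma corrExp_eq (τ : ℝ) :
    corrExp b σ ℓ n r τ = dupExpElim b σ ℓ n r τ + (1 - dupMatrix n r * elimMatrix n r) := by
  rw [corrExp, dupExpElim, ← exp_mul_mul_of_mul_eq_one (elimMatrix_mul_dupMatrix n r),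
    corrGenerator, Matrix.mul_smul, Matrix.smul_mul]

lemma corrExp_mulVec_vecPow (τ x : ℝ) :
    corrExp b σ ℓ n r τ *ᵥ vecPow n r x = dupExpElim b σ ℓ n r τ *ᵥ vecPow n r x := by
  rw [corrExp_eq, Matrix.add_mulVec, Matrix.sub_mulVec, ← Matrix.mulVec_mulVec,
    vecPow_eq_tensorMonomials, elimMatrix_mulVec, dupMatrix_mulVec, Matrix.one_mulVec, sub_self,
    add_zero]

lemma dupExpElim_mulVec_tensorMonomials (τ x : ℝ) :
    dupExpElim b σ ℓ n r τ *ᵥ tensorMonomials n (r + 1) x = dupMatrix n r *ᵥ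
      (NormedSpace.exp (τ • generatorMatrix b σ ℓ (n * (r + 1))) *ᵥ
        monomialVec (n * (r + 1)) x) := by
  rw [dupExpElim, ← Matrix.mulVec_mulVec, ← Matrix.mulVec_mulVec, elimMatrix_mulVec]

lemma corrGenerator_zero :
    corrGenerator b σ ℓ n 0 = mcast (by simp) (by simp) (generatorMatrix b σ ℓ n) := by
  -- `n * (0 + 1)` is not `n` definitionally, so the dimension is abstracted before substituting.
  have key : ∀ N (_ : N = n) (h1 : n + 1 = N + 1) (h2 : n + 1 = (n + 1) ^ 1),
      mcast h2 h1 (1 : Matrix (Fin (n + 1)) (Fin (n + 1)) ℝ) * generatorMatrix b σ ℓ N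
        * mcast h1 h2 (1 : Matrix (Fin (n + 1)) (Fin (n + 1)) ℝ)
      = mcast h2 h2 (generatorMatrix b σ ℓ n) := by
    rintro N rfl h1 h2
    have hcast : generatorMatrix b σ ℓ N = mcast h1 h1 (generatorMatrix b σ ℓ N) := rfl
    rw [hcast, mcast_mul_mcast, mcast_mul_mcast, Matrix.one_mul, Matrix.mul_one]
    rfl
  exact key _ (by simp) _ _

end CorrelatorMatrices

/-! ### The matrices `I ⊗^r p` -/

section IdKronCoeff

variable (n r : ℕ) (p : ℝ[X])

lemma idKronCoeff_snocIdx (j : Fin ((n + 1) ^ r)) (i : Fin (n + 1)) (k : Fin ((n + 1) ^ r)) :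
    idKronCoeff n r p (snocIdx j i) k = if j = k then p.coeff i else 0 := by
  have hk : (Fin.cast (by simp) k : Fin ((n + 1) ^ r * 1)) =
      finProdFinEquiv (k, (0 : Fin 1)) := by
    ext; simp
  simp only [idKronCoeff, mcast, Matrix.submatrix_apply, snocIdx, Fin.cast_cast, Fin.cast_refl, id,
    hk, dKron, kron_apply, kronPow_one, Matrix.one_apply, coeffCol, Matrix.of_apply, ite_mul,
    one_mul, zero_mul]

lemma vecMul_idKronCoeff (w : Fin ((n + 1) ^ (r + 1)) → ℝ) (k : Fin ((n + 1) ^ r)) :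
    (w ᵥ* idKronCoeff n r p) k = ∑ i : Fin (n + 1), w (snocIdx k i) * p.coeff i := by
  simp only [Matrix.vecMul, dotProduct, sum_snocIdx, idKronCoeff_snocIdx, mul_ite, mul_zero]
  rw [Finset.sum_comm]
  simp only [Finset.sum_ite_eq', Finset.mem_univ, if_true]

lemma coeffCol_mul_vecInv (w : Fin ((n + 1) ^ (r + 1)) → ℝ) (k : Fin ((n + 1) ^ r)) :
    ((coeffCol n p)ᵀ * vecInv (pow_succ (n + 1) r) w) 0 k = (w ᵥ* idKronCoeff n r p) k := by
  rw [vecMul_idKronCoeff, Matrix.mul_apply]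
  exact Finset.sum_congr rfl fun i _ => mul_comm _ _

variable {n p}

lemma tensorMonomials_vecMul_idKronCoeff (hp : p.natDegree ≤ n) (x : ℝ) :
    tensorMonomials n (r + 1) x ᵥ* idKronCoeff n r p = p.eval x • tensorMonomials n r x := by
  ext k
  rw [vecMul_idKronCoeff, Polynomial.eval_eq_sum_range' (Nat.lt_succ_of_le hp),
    Finset.sum_range, Pi.smul_apply, smul_eq_mul, Finset.sum_mul]
  refine Finset.sum_congr rfl fun i _ => ?_
  rw [tensorMonomials_snocIdx]
  ring

end IdKronCoeff

/-! ### Integral equations and inequalities -/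

lemma hasDerivWithinAt_Ici_integral {E : Type*} [NormedAddCommGroup E] [NormedSpace ℝ E]
    [CompleteSpace E] {f : ℝ → E} {s t u : ℝ} (hf : IntervalIntegrable f volume s t)
    (hu : u ∈ Set.Ico s t) (hc : ContinuousWithinAt f (Set.Ici u) u) :
    HasDerivWithinAt (fun v => ∫ x in s..v, f x) (f u) (Set.Ici u) u := by
  have hst : s ≤ t := hu.1.trans hu.2.le
  refine intervalIntegral.integral_hasDerivWithinAt_right (t := Set.Ioi u)
    (hf.mono_set ?_) ⟨Set.Ioc s t, ?_, hf.1.aestronglyMeasurable⟩ (hc.mono Set.Ioi_subset_Ici_self)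
  · rw [Set.uIcc_of_le hu.1, Set.uIcc_of_le hst]
    exact Set.Icc_subset_Icc_right hu.2.le
  · exact mem_of_superset (Ioc_mem_nhdsGT hu.2) (Set.Ioc_subset_Ioc_left hu.1)

lemma le_mul_exp_of_le_add_mul_integral {f : ℝ → ℝ} {s t a C : ℝ} (hC : 0 ≤ C)
    (hf : IntervalIntegrable f volume s t)
    (hc : ∀ u ∈ Set.Ico s t, ContinuousWithinAt f (Set.Ici u) u)
    (h : ∀ u ∈ Set.Icc s t, f u ≤ a + C * ∫ v in s..u, f v) :
    ∀ u ∈ Set.Icc s t, f u ≤ a * Real.exp (C * (u - s)) := by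
  intro u hu
  have hst : s ≤ t := hu.1.trans hu.2
  have hprim : ContinuousOn (fun u => ∫ v in s..u, f v) (Set.Icc s t) := by
    rw [← Set.uIcc_of_le hst]
    exact intervalIntegral.continuousOn_primitive_interval' hf Set.left_mem_uIcc
  have hbound : ∫ v in s..u, f v ≤ gronwallBound 0 C a (u - s) :=
    le_gronwallBound_of_liminf_deriv_right_le hprim
      (fun v hv r hr => (hasDerivWithinAt_Ici_integral hf hv (hc v hv)).liminf_right_slope_le hr)
      (by simp) (fun v hv => by linarith [h v (Set.Ico_subset_Icc_self hv)]) u hu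
  calc f u ≤ a + C * gronwallBound 0 C a (u - s) := by
        linarith [h u hu, mul_le_mul_of_nonneg_left hbound hC]
    _ = a * Real.exp (C * (u - s)) := by
        rcases hC.eq_or_lt' with rfl | hC
        · simp
        · rw [gronwallBound_of_K_ne_0 hC.ne']
          field_simp
          ring

section LinearEquation

open scoped Matrix.Norms.Operator

variable {ι : Type*} [Fintype ι] [DecidableEq ι] (G : Matrix ι ι ℝ)

lemma hasDerivAt_exp_smul_mulVec (v : ι → ℝ) (u : ℝ) :
    HasDerivAt (fun u : ℝ => NormedSpace.exp (u • G) *ᵥ v)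
      (G *ᵥ (NormedSpace.exp (u • G) *ᵥ v)) u := by
  rw [Matrix.mulVec_mulVec]
  exact (LinearMap.toContinuousLinearMap ((Matrix.mulVecBilin ℝ ℝ).flip v)).hasFDerivAt
    |>.comp_hasDerivAt u (hasDerivAt_exp_smul_const' G u)

lemma eq_exp_smul_mulVec_of_eq_add_integral {m : ℝ → ι → ℝ} {s t : ℝ} (hst : s ≤ t)
    (hm : IntervalIntegrable m volume s t)
    (h : ∀ u ∈ Set.Icc s t, m u = m s + ∫ v in s..u, G *ᵥ m v) :
    m t = NormedSpace.exp ((t - s) • G) *ᵥ m s := by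
  let A : (ι → ℝ) →L[ℝ] (ι → ℝ) := G.mulVecLin.toContinuousLinearMap
  have hGm : IntervalIntegrable (fun v => A (m v)) volume s t :=
    ⟨A.integrable_comp hm.1, A.integrable_comp hm.2⟩
  have hcont : ContinuousOn m (Set.Icc s t) := by
    refine ContinuousOn.congr (f := fun u => m s + ∫ v in s..u, A (m v)) ?_ h
    rw [← Set.uIcc_of_le hst]
    exact continuousOn_const.add
      (intervalIntegral.continuousOn_primitive_interval' hGm Set.left_mem_uIcc)
  have hderiv : ∀ u ∈ Set.Ico s t, HasDerivWithinAt m (A (m u)) (Set.Ici u) u := by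
    intro u hu
    have hmem : Set.Icc s t ∈ 𝓝[≥] u :=
      mem_of_superset (Icc_mem_nhdsGE hu.2) (Set.Icc_subset_Icc_left hu.1)
    have hright : ContinuousWithinAt m (Set.Ici u) u :=
      (hcont u (Set.Ico_subset_Icc_self hu)).mono_of_mem_nhdsWithin hmem
    have hintegral := hasDerivWithinAt_Ici_integral hGm hu
      (A.continuous.continuousAt.comp_continuousWithinAt hright)
    refine (hintegral.const_add (m s)).congr_of_eventuallyEq ?_ (h u (Set.Ico_subset_Icc_self hu))
    filter_upwards [hmem] with v hv using h v hv
  have hsol (u : ℝ) : HasDerivAt (fun u => NormedSpace.exp ((u - s) • G) *ᵥ m s)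
      (A (NormedSpace.exp ((u - s) • G) *ᵥ m s)) u :=
    (hasDerivAt_exp_smul_mulVec G (m s) (u - s)).comp_sub_const u s
  exact ODE_solution_unique_of_mem_Icc_right (v := fun _ => A) (s := fun _ => Set.univ)
    (fun _ _ => A.lipschitz.lipschitzOnWith) hcont hderiv (fun _ _ => Set.mem_univ _)
    (fun u _ => (hsol u).continuousAt.continuousWithinAt) (fun u _ => (hsol u).hasDerivWithinAt)
    (fun _ _ => Set.mem_univ _) (by simp) ⟨hst, le_rfl⟩

end LinearEquation

/-! ### Functions of polynomial growth -/

/-- The class on which the generator is controlled by moments: `C²` functions which, together with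
their first two derivatives, are bounded by `K (1 + x²)^j`. -/
structure PolyGrowth (K : ℝ) (j : ℕ) (f : ℝ → ℝ) : Prop where
  contDiff : ContDiff ℝ 2 f
  abs_le : ∀ x, |f x| ≤ K * (1 + x ^ 2) ^ j
  abs_deriv_le : ∀ x, |deriv f x| ≤ K * (1 + x ^ 2) ^ j
  abs_deriv_deriv_le : ∀ x, |deriv (deriv f) x| ≤ K * (1 + x ^ 2) ^ j

lemma one_le_one_add_sq (x : ℝ) : 1 ≤ 1 + x ^ 2 := le_add_of_nonneg_right (sq_nonneg x)

lemma abs_pow_le_one_add_sq_pow {i j : ℕ} (hi : i ≤ 2 * j) (x : ℝ) :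
    |x| ^ i ≤ (1 + x ^ 2) ^ j := by
  rcases le_total |x| 1 with hx | hx
  · exact (pow_le_one₀ (abs_nonneg x) hx).trans (one_le_pow₀ (one_le_one_add_sq x))
  · calc |x| ^ i ≤ |x| ^ (2 * j) := pow_le_pow_right₀ hx hi
      _ = (x ^ 2) ^ j := by rw [pow_mul, sq_abs]
      _ ≤ (1 + x ^ 2) ^ j := by gcongr; exact le_add_of_nonneg_left zero_le_one

lemma abs_eval_le (q : ℝ[X]) {j : ℕ} (hq : q.natDegree ≤ 2 * j) (x : ℝ) :
    |q.eval x| ≤ (∑ i ∈ Finset.range (2 * j + 1), |q.coeff i|) * (1 + x ^ 2) ^ j := by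
  rw [Polynomial.eval_eq_sum_range' (Nat.lt_succ_of_le hq), Finset.sum_mul]
  refine (Finset.abs_sum_le_sum_abs _ _).trans (Finset.sum_le_sum fun i hi => ?_)
  rw [abs_mul, abs_pow]
  gcongr
  exact abs_pow_le_one_add_sq_pow (Finset.mem_range_succ_iff.1 hi) x

lemma exists_abs_eval_le (q : ℝ[X]) : ∃ q' : ℝ[X], ∀ x, |q.eval x| ≤ q'.eval x :=
  ⟨1 + q ^ 2, fun x => by
    simp only [Polynomial.eval_add, Polynomial.eval_one, Polynomial.eval_pow]
    nlinarith [sq_nonneg (|q.eval x| - 1), sq_abs (q.eval x)]⟩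

lemma deriv_eval (p : ℝ[X]) : deriv (fun u => p.eval u) = fun u => p.derivative.eval u :=
  funext fun _ => p.deriv

lemma contDiff_eval (p : ℝ[X]) (n : WithTop ℕ∞) : ContDiff ℝ n fun u => p.eval u := by
  simpa using p.contDiff_aeval (𝕜 := ℝ) n

lemma exists_polyGrowth_of_abs_le_eval {f : ℝ → ℝ} {q : ℝ[X]} (hf : ContDiff ℝ 2 f)
    (h : ∀ x, |f x| ≤ q.eval x) (h' : ∀ x, |deriv f x| ≤ q.eval x)
    (h'' : ∀ x, |deriv (deriv f) x| ≤ q.eval x) : ∃ K j, PolyGrowth K j f :=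
  have hq (x : ℝ) := (le_abs_self _).trans (abs_eval_le q (Nat.le_mul_of_pos_left _ two_pos) x)
  ⟨_, _, hf, fun x => (h x).trans (hq x), fun x => (h' x).trans (hq x),
    fun x => (h'' x).trans (hq x)⟩

lemma exists_polyGrowth_eval (p : ℝ[X]) : ∃ K j, PolyGrowth K j fun u => p.eval u := by
  obtain ⟨q, h⟩ := exists_abs_eval_le p
  obtain ⟨q', h'⟩ := exists_abs_eval_le p.derivative
  obtain ⟨q'', h''⟩ := exists_abs_eval_le p.derivative.derivative
  have h0 (x : ℝ) := (abs_nonneg _).trans (h x)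
  have h0' (x : ℝ) := (abs_nonneg _).trans (h' x)
  have h0'' (x : ℝ) := (abs_nonneg _).trans (h'' x)
  refine exists_polyGrowth_of_abs_le_eval (q := q + q' + q'') (contDiff_eval p 2)
    (fun x => ?_) (fun x => ?_) (fun x => ?_) <;>
    simp only [deriv_eval, Polynomial.eval_add]
  · linarith [h x, h0' x, h0'' x]
  · linarith [h' x, h0 x, h0'' x]
  · linarith [h'' x, h0 x, h0' x]

lemma contDiff_one_deriv {f : ℝ → ℝ} (hf : ContDiff ℝ 2 f) : ContDiff ℝ 1 (deriv f) :=
  (contDiff_succ_iff_deriv (n := 1).1 (by simpa [one_add_one_eq_two] using hf)).2.2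

lemma abs_taylor_remainder_le {f : ℝ → ℝ} (hf : ContDiff ℝ 2 f) {x z K : ℝ}
    (hK : ∀ u ∈ Set.uIcc x (x + z), |deriv (deriv f) u| ≤ K) :
    |f (x + z) - f x - deriv f x * z| ≤ K * z ^ 2 := by
  have hd : Differentiable ℝ f := hf.differentiable two_ne_zero
  have hdd : Differentiable ℝ (deriv f) := (contDiff_one_deriv hf).differentiable one_ne_zero
  have hconv : Convex ℝ (Set.uIcc x (x + z)) := convex_uIcc _ _
  have hx : x ∈ Set.uIcc x (x + z) := Set.left_mem_uIcc
  have hK0 : 0 ≤ K := (abs_nonneg _).trans (hK x hx)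
  have hderiv : ∀ u ∈ Set.uIcc x (x + z), ‖deriv f u - deriv f x‖ ≤ K * |z| := by
    intro u hu
    have hux : ‖u - x‖ ≤ |z| := by simpa using Set.abs_sub_left_of_mem_uIcc hu
    exact (hconv.norm_image_sub_le_of_norm_deriv_le (fun v _ => hdd v) hK hx hu).trans (by gcongr)
  have hg (v : ℝ) : HasDerivAt (fun u => f u - deriv f x * u) (deriv f v - deriv f x) v := by
    simpa only [mul_one] using (hd v).hasDerivAt.fun_sub ((hasDerivAt_id' v).const_mul (deriv f x))
  have hmean := hconv.norm_image_sub_le_of_norm_hasDerivWithin_le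
    (fun v _ => (hg v).hasDerivWithinAt) hderiv hx Set.right_mem_uIcc
  simp only [Real.norm_eq_abs, add_sub_cancel_left] at hmean
  calc |f (x + z) - f x - deriv f x * z|
      = |f (x + z) - deriv f x * (x + z) - (f x - deriv f x * x)| := by ring_nf
    _ ≤ K * |z| * |z| := hmean
    _ = K * z ^ 2 := by rw [mul_assoc, abs_mul_abs_self, sq]

namespace PolyGrowth

variable {f : ℝ → ℝ} {K : ℝ} {j : ℕ}

lemma nonneg (hf : PolyGrowth K j f) : 0 ≤ K := by
  simpa using (abs_nonneg _).trans (hf.abs_le 0)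

lemma abs_increment_le (hf : PolyGrowth K j f) (x z : ℝ) :
    |f (x + z) - f x - deriv f x * z|
      ≤ K * (2 ^ j * (1 + x ^ 2) ^ j) * (z ^ 2 * (1 + z ^ 2) ^ j) := by
  have hK := hf.nonneg
  have hmid : ∀ u ∈ Set.uIcc x (x + z),
      |deriv (deriv f) u| ≤ K * (2 ^ j * (1 + x ^ 2) ^ j * (1 + z ^ 2) ^ j) := by
    intro u hu
    refine (hf.abs_deriv_deriv_le u).trans ?_
    rw [← mul_pow, ← mul_pow]
    gcongr
    have huz : (u - x) ^ 2 ≤ z ^ 2 :=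
      sq_le_sq.2 (by simpa using Set.abs_sub_left_of_mem_uIcc hu)
    nlinarith [sq_nonneg (u - 2 * x), sq_nonneg (x * z)]
  exact (abs_taylor_remainder_le hf.contDiff hmid).trans (le_of_eq (by ring))

end PolyGrowth

/-! ### The generator on polynomials and on functions of polynomial growth -/

section Generator

variable {b σ : ℝ → ℝ} {ℓ : Kernel ℝ ℝ}

lemma generator_eval (p : ℝ[X]) (x : ℝ) :
    generator b σ ℓ (fun u => p.eval u) x = b x * p.derivative.eval x
      + 1 / 2 * σ x ^ 2 * p.derivative.derivative.eval x
      + ∫ z, (p.eval (x + z) - p.eval x - p.derivative.eval x * z) ∂(ℓ x) := by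
  simp only [generator, deriv_eval]

lemma generator_centered_pow {k : ℕ} (hk : 2 ≤ k) (x : ℝ) :
    generator b σ ℓ (fun u => (u - x) ^ k) x
      = (if k = 2 then σ x ^ 2 else 0) + ∫ z, z ^ k ∂(ℓ x) := by
  have hd (i : ℕ) : deriv (fun u => (u - x) ^ i) = fun u => i * (u - x) ^ (i - 1) := by
    ext u; simp
  have hdd : deriv (fun u => (k : ℝ) * (u - x) ^ (k - 1)) x
      = k * ((k - 1 : ℕ) * 0 ^ (k - 1 - 1)) := by
    simp only [deriv_const_mul_field, hd, sub_self]
  simp only [generator, hd, hdd, sub_self, zero_pow (show k - 1 ≠ 0 by omega),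
    zero_pow (show k ≠ 0 by omega), add_sub_cancel_left, mul_zero, zero_mul, sub_zero, zero_add]
  split_ifs with h
  · subst h
    norm_num
    ring
  · simp only [zero_pow (show k - 1 - 1 ≠ 0 by omega), mul_zero]

namespace IsPolynomialOperator

lemma integrable_moment (hpol : IsPolynomialOperator b σ ℓ) (x : ℝ) {k : ℕ} (hk : 2 ≤ k) :
    Integrable (fun z : ℝ => z ^ k) (ℓ x) :=
  (hpol.integrable_pow x k hk).mono' (by fun_prop) (ae_of_all _ fun z => by simp)

lemma integrable_sq_mul_eval (hpol : IsPolynomialOperator b σ ℓ) (x : ℝ) (r : ℝ[X]) :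
    Integrable (fun z : ℝ => z ^ 2 * r.eval z) (ℓ x) := by
  simp_rw [Polynomial.eval_eq_sum_range, Finset.mul_sum]
  refine integrable_finsetSum _ fun i _ => ?_
  exact ((hpol.integrable_moment x (k := i + 2) (by omega)).const_mul (r.coeff i)).congr
    (ae_of_all _ fun z => by ring)

lemma integrable_weight (hpol : IsPolynomialOperator b σ ℓ) (j : ℕ) (x : ℝ) :
    Integrable (fun z : ℝ => z ^ 2 * (1 + z ^ 2) ^ j) (ℓ x) :=
  (hpol.integrable_sq_mul_eval x ((1 + Polynomial.X ^ 2) ^ j)).congr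
    (ae_of_all _ fun z => by simp)

lemma integrable_increment (hpol : IsPolynomialOperator b σ ℓ) {f : ℝ → ℝ} {K : ℝ} {j : ℕ}
    (hf : PolyGrowth K j f) (x : ℝ) :
    Integrable (fun z => f (x + z) - f x - deriv f x * z) (ℓ x) := by
  have hc := hf.contDiff.continuous
  exact ((hpol.integrable_weight j x).const_mul _).mono' (by fun_prop)
    (ae_of_all _ (hf.abs_increment_le x))

lemma integrable_increment_eval (hpol : IsPolynomialOperator b σ ℓ) (p : ℝ[X]) (x : ℝ) :
    Integrable (fun z : ℝ => p.eval (x + z) - p.eval x - p.derivative.eval x * z) (ℓ x) := by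
  obtain ⟨K, j, hp⟩ := exists_polyGrowth_eval p
  simpa only [deriv_eval] using hpol.integrable_increment hp x

/-- The functional `p ↦ 𝒢 p (x)` on polynomials; it is linear because the jump integrals
converge. -/
def evalGenerator (hpol : IsPolynomialOperator b σ ℓ) (x : ℝ) : ℝ[X] →ₗ[ℝ] ℝ where
  toFun p := generator b σ ℓ (fun u => p.eval u) x
  map_add' p q := by
    have hjump : ∫ z, ((p + q).eval (x + z) - (p + q).eval x
          - (p + q).derivative.eval x * z) ∂(ℓ x)
        = ∫ z, (p.eval (x + z) - p.eval x - p.derivative.eval x * z) ∂(ℓ x)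
          + ∫ z, (q.eval (x + z) - q.eval x - q.derivative.eval x * z) ∂(ℓ x) := by
      rw [← integral_add (hpol.integrable_increment_eval p x) (hpol.integrable_increment_eval q x)]
      congr 1 with z
      simp only [Polynomial.eval_add, Polynomial.derivative_add]
      ring
    rw [generator_eval, generator_eval, generator_eval, hjump]
    simp only [Polynomial.eval_add, Polynomial.derivative_add]
    ring
  map_smul' c p := by
    have hjump : ∫ z, ((c • p).eval (x + z) - (c • p).eval x
          - (c • p).derivative.eval x * z) ∂(ℓ x)
        = c * ∫ z, (p.eval (x + z) - p.eval x - p.derivative.eval x * z) ∂(ℓ x) := by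
      rw [← integral_const_mul]
      congr 1 with z
      simp only [Polynomial.eval_smul, Polynomial.derivative_smul, smul_eq_mul]
      ring
    rw [generator_eval, generator_eval, hjump]
    simp only [Polynomial.eval_smul, Polynomial.derivative_smul, smul_eq_mul, RingHom.id_apply]
    ring

lemma exists_generator_centered_pow_eq (hpol : IsPolynomialOperator b σ ℓ) (k : ℕ) :
    ∃ q : ℝ[X], ∀ x, generator b σ ℓ (fun u => (u - x) ^ k) x = q.eval x := by
  choose q _ hq using fun i : ℕ => hpol.map_degree_le i (Polynomial.X ^ i) (by simp)
  refine ⟨∑ i ∈ Finset.range (k + 1),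
    (-Polynomial.X) ^ (k - i) * Polynomial.C (k.choose i : ℝ) * q i, fun x => ?_⟩
  have hbinom : (Polynomial.X - Polynomial.C x : ℝ[X]) ^ k = ∑ i ∈ Finset.range (k + 1),
      ((-x) ^ (k - i) * (k.choose i : ℝ)) • (Polynomial.X : ℝ[X]) ^ i := by
    rw [sub_eq_add_neg, add_pow]
    refine Finset.sum_congr rfl fun i _ => ?_
    simp only [← Polynomial.C_neg, ← Polynomial.C_pow, ← Polynomial.C_eq_natCast,
      Polynomial.smul_eq_C_mul, Polynomial.C_mul]
    ring
  calc generator b σ ℓ (fun u => (u - x) ^ k) x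
      = hpol.evalGenerator x ((Polynomial.X - Polynomial.C x : ℝ[X]) ^ k) := by
        simp [evalGenerator]
    _ = ∑ i ∈ Finset.range (k + 1), (-x) ^ (k - i) * (k.choose i : ℝ) * (q i).eval x := by
        rw [hbinom, map_sum]
        refine Finset.sum_congr rfl fun i _ => ?_
        rw [map_smul, smul_eq_mul, ← hq i x]
        rfl
    _ = _ := by simp [Polynomial.eval_finsetSum]

lemma exists_drift_eq (hpol : IsPolynomialOperator b σ ℓ) : ∃ q : ℝ[X], ∀ x, b x = q.eval x := by
  obtain ⟨q, -, hq⟩ := hpol.map_degree_le 1 Polynomial.X (by simp)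
  refine ⟨q, fun x => ?_⟩
  rw [← hq x, generator_eval]
  simp

lemma exists_sq_diffusion_le (hpol : IsPolynomialOperator b σ ℓ) :
    ∃ q : ℝ[X], ∀ x, σ x ^ 2 ≤ q.eval x := by
  obtain ⟨q, hq⟩ := hpol.exists_generator_centered_pow_eq 2
  refine ⟨q, fun x => ?_⟩
  rw [← hq, generator_centered_pow le_rfl, if_pos rfl]
  exact le_add_of_nonneg_right (integral_nonneg fun z => sq_nonneg z)

lemma exists_moment_le (hpol : IsPolynomialOperator b σ ℓ) {k : ℕ} (hk : 2 ≤ k) :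
    ∃ q : ℝ[X], ∀ x, ∫ z, z ^ k ∂(ℓ x) ≤ q.eval x := by
  obtain ⟨q, hq⟩ := hpol.exists_generator_centered_pow_eq k
  refine ⟨q, fun x => ?_⟩
  rw [← hq, generator_centered_pow hk]
  exact le_add_of_nonneg_left (by split_ifs <;> positivity)

lemma exists_integral_weight_le (hpol : IsPolynomialOperator b σ ℓ) (j : ℕ) :
    ∃ q : ℝ[X], ∀ x, ∫ z, z ^ 2 * (1 + z ^ 2) ^ j ∂(ℓ x) ≤ q.eval x := by
  have hk (i : ℕ) : 2 ≤ 2 * i + 2 := Nat.le_add_left 2 (2 * i)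
  choose q hq using fun i : ℕ => hpol.exists_moment_le (hk i)
  refine ⟨∑ i ∈ Finset.range (j + 1), Polynomial.C (j.choose i : ℝ) * q i, fun x => ?_⟩
  calc ∫ z, z ^ 2 * (1 + z ^ 2) ^ j ∂(ℓ x)
      = ∫ z, ∑ i ∈ Finset.range (j + 1), (j.choose i : ℝ) * z ^ (2 * i + 2) ∂(ℓ x) := by
        congr 1 with z
        rw [add_comm, add_pow, Finset.mul_sum]
        exact Finset.sum_congr rfl fun i _ => by ring
    _ = ∑ i ∈ Finset.range (j + 1), (j.choose i : ℝ) * ∫ z, z ^ (2 * i + 2) ∂(ℓ x) := by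
        rw [integral_finsetSum _ fun i _ => (hpol.integrable_moment x (hk i)).const_mul _]
        simp only [integral_const_mul]
    _ ≤ ∑ i ∈ Finset.range (j + 1), (j.choose i : ℝ) * (q i).eval x := by
        gcongr with i
        exact hq i x
    _ = _ := by simp [Polynomial.eval_finsetSum]

lemma exists_abs_generator_le (hpol : IsPolynomialOperator b σ ℓ) (j : ℕ) :
    ∃ q : ℝ[X], ∀ (f : ℝ → ℝ) (K : ℝ), PolyGrowth K j f →
      ∀ x, |generator b σ ℓ f x| ≤ K * q.eval x := by
  obtain ⟨qb, hb⟩ := hpol.exists_drift_eq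
  obtain ⟨qb', hb'⟩ := exists_abs_eval_le qb
  obtain ⟨qσ, hσ⟩ := hpol.exists_sq_diffusion_le
  obtain ⟨qℓ, hℓ⟩ := hpol.exists_integral_weight_le j
  refine ⟨(1 + Polynomial.X ^ 2) ^ j *
    (qb' + Polynomial.C (1 / 2) * qσ + Polynomial.C (2 ^ j) * qℓ), fun f K hf x => ?_⟩
  have hK := hf.nonneg
  have hdrift : |b x * deriv f x| ≤ qb'.eval x * (K * (1 + x ^ 2) ^ j) := by
    rw [abs_mul, hb]
    have h0 := (abs_nonneg _).trans (hb' x)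
    gcongr
    exacts [hb' x, hf.abs_deriv_le x]
  have hdiffusion : |1 / 2 * σ x ^ 2 * deriv (deriv f) x|
      ≤ 1 / 2 * qσ.eval x * (K * (1 + x ^ 2) ^ j) := by
    rw [abs_mul, abs_of_nonneg (by positivity : 0 ≤ 1 / 2 * σ x ^ 2)]
    have h0 := (sq_nonneg _).trans (hσ x)
    gcongr
    exacts [hσ x, hf.abs_deriv_deriv_le x]
  have hjump : |∫ z, (f (x + z) - f x - deriv f x * z) ∂(ℓ x)|
      ≤ K * (2 ^ j * (1 + x ^ 2) ^ j) * qℓ.eval x := by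
    calc |∫ z, (f (x + z) - f x - deriv f x * z) ∂(ℓ x)|
        ≤ ∫ z, K * (2 ^ j * (1 + x ^ 2) ^ j) * (z ^ 2 * (1 + z ^ 2) ^ j) ∂(ℓ x) :=
          (Real.norm_eq_abs _).symm.trans_le <| norm_integral_le_of_norm_le
            ((hpol.integrable_weight j x).const_mul _) (ae_of_all _ (hf.abs_increment_le x))
      _ ≤ K * (2 ^ j * (1 + x ^ 2) ^ j) * qℓ.eval x := by
          rw [integral_const_mul]
          gcongr
          exact hℓ x
  refine (abs_add_three _ _ _).trans ((add_le_add_three hdrift hdiffusion hjump).trans_eq ?_)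
  simp only [Polynomial.eval_mul, Polynomial.eval_add, Polynomial.eval_pow, Polynomial.eval_one,
    Polynomial.eval_X, Polynomial.eval_C]
  ring

end IsPolynomialOperator

/-! ### Measurability of the generator -/

/-- The kernel need not be s-finite; renormalising `w z κ(x, dz)` to mass at most one makes the
measurability of kernel integrals available. -/
lemma measurable_integral_kernel_mul {α β : Type*} [MeasurableSpace α] [MeasurableSpace β]
    (κ : Kernel α β) {w : β → ℝ≥0} (hw : Measurable w) (hκ : ∀ x, ∫⁻ z, w z ∂κ x ≠ ⊤)
    {F : α × β → ℝ} (hF : Measurable F) : Measurable fun x => ∫ z, w z * F (x, z) ∂κ x := by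
  have hw' : Measurable fun z => (w z : ENNReal) := hw.coe_nnreal_ennreal
  have hmass : Measurable fun x => 1 + ∫⁻ z, w z ∂κ x := measurable_const.add hw'.lintegral_kernel
  have hmass_top (x : α) : 1 + ∫⁻ z, w z ∂κ x ≠ ⊤ := ENNReal.add_ne_top.2 ⟨by simp, hκ x⟩
  let η : Kernel α β :=
    { toFun := fun x => (1 + ∫⁻ z, w z ∂κ x)⁻¹ • (κ x).withDensity fun z => w z
      measurable' := by
        refine Measure.measurable_of_measurable_coe _ fun s hs => ?_
        simp only [Measure.smul_apply, withDensity_apply _ hs, smul_eq_mul]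
        simp_rw [← lintegral_indicator hs]
        exact hmass.inv.mul (hw'.indicator hs).lintegral_kernel }
  have hη (x : α) : η x = (1 + ∫⁻ z, w z ∂κ x)⁻¹ • (κ x).withDensity fun z => w z := rfl
  have : IsFiniteKernel η := by
    refine ⟨1, ENNReal.one_lt_top, fun x => ?_⟩
    rw [hη, Measure.smul_apply, withDensity_apply _ MeasurableSet.univ, setLIntegral_univ,
      smul_eq_mul, ← ENNReal.div_eq_inv_mul]
    exact ENNReal.div_le_of_le_mul (by rw [one_mul]; exact le_add_self)
  have hint (x : α) : ∫ z, w z * F (x, z) ∂κ x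
      = (1 + ∫⁻ z, w z ∂κ x).toReal * ∫ z, F (x, z) ∂η x := by
    rw [hη, integral_smul_measure, integral_withDensity_eq_integral_smul hw, ENNReal.toReal_inv,
      smul_eq_mul, mul_inv_cancel_left₀ (ENNReal.toReal_pos (by simp) (hmass_top x)).ne']
    rfl
  simp_rw [hint]
  exact hmass.ennreal_toReal.mul hF.stronglyMeasurable.integral_kernel_prod_right'.measurable

lemma IsPolynomialOperator.measurable_generator (hpol : IsPolynomialOperator b σ ℓ)
    (hop : IsJumpDiffusionOperator b σ ℓ) {f : ℝ → ℝ} (hf : Measurable f) :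
    Measurable (generator b σ ℓ f) := by
  have hb := hop.measurable_b
  have hσ := hop.measurable_σ
  have : Measurable (deriv f) := measurable_deriv f
  have : Measurable (deriv (deriv f)) := measurable_deriv _
  have hw : Measurable fun z : ℝ => Real.toNNReal (z ^ 2) := by fun_prop
  have hfin (x : ℝ) : ∫⁻ z, Real.toNNReal (z ^ 2) ∂ℓ x ≠ ⊤ :=
    (hpol.integrable_moment x le_rfl).lintegral_lt_top.ne
  have hjump := measurable_integral_kernel_mul ℓ hw hfin
    (F := fun q => (f (q.1 + q.2) - f q.1 - deriv f q.1 * q.2) / q.2 ^ 2) (by fun_prop)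
  have hincr (x z : ℝ) : Real.toNNReal (z ^ 2) * ((f (x + z) - f x - deriv f x * z) / z ^ 2)
      = f (x + z) - f x - deriv f x * z := by
    rw [Real.coe_toNNReal _ (sq_nonneg z)]
    rcases eq_or_ne z 0 with rfl | hz
    · simp
    · field_simp
  simp only [hincr] at hjump
  unfold generator
  fun_prop

/-! ### Generator matrices -/

lemma IsPolynomialOperator.isGeneratorMatrix (hpol : IsPolynomialOperator b σ ℓ) (k : ℕ) :
    IsGeneratorMatrix b σ ℓ k (generatorMatrix b σ ℓ k) := by
  have hex : ∃ M, IsGeneratorMatrix b σ ℓ k M := by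
    choose q hq h using fun i : ℕ => hpol.map_degree_le i (Polynomial.X ^ i) (by simp)
    refine ⟨Matrix.of fun i j => (q i).coeff j, fun x => ?_⟩
    ext i l
    have hx := h i x
    simp only [Polynomial.eval_pow, Polynomial.eval_X] at hx
    rw [Matrix.of_apply, hx, Matrix.mul_apply,
      Polynomial.eval_eq_sum_range' (Nat.lt_succ_of_le ((hq i).trans i.is_le)), Finset.sum_range]
    rfl
  rw [generatorMatrix, dif_pos hex]
  exact hex.choose_spec

lemma IsPolynomialOperator.generator_monomialVec (hpol : IsPolynomialOperator b σ ℓ) (k : ℕ)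
    (x : ℝ) : (fun i : Fin (k + 1) => generator b σ ℓ (fun u => u ^ (i : ℕ)) x)
      = generatorMatrix b σ ℓ k *ᵥ monomialVec k x :=
  funext fun i => congrFun (congrFun (hpol.isGeneratorMatrix k x) i) 0

end Generator

/-! ### Bounded truncations -/

section Truncation

variable {b σ : ℝ → ℝ} {ℓ : Kernel ℝ ℝ}

/-- The bounded truncation `V / (1 + ε V)` of a nonnegative polynomial; since `v ↦ v / (1 + ε v)`
is concave, it inherits Lyapunov bounds on the generator from `V`. -/
def truncPoly (V : ℝ[X]) (ε x : ℝ) : ℝ := V.eval x / (1 + ε * V.eval x)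

lemma div_one_add_mul_le_tangent {ε v w : ℝ} (hε : 0 < ε) (hv : 0 ≤ v) (hw : 0 ≤ w) :
    w / (1 + ε * w) ≤ v / (1 + ε * v) + (w - v) / (1 + ε * v) ^ 2 := by
  have h : v / (1 + ε * v) + (w - v) / (1 + ε * v) ^ 2 - w / (1 + ε * w)
      = ε * (w - v) ^ 2 / ((1 + ε * v) ^ 2 * (1 + ε * w)) := by
    field_simp
    ring
  rw [← sub_nonneg, h]
  positivity

section TruncPoly

variable {V : ℝ[X]} {ε : ℝ}

lemma one_le_one_add_mul_eval (hV : ∀ x, 0 ≤ V.eval x) (hε : 0 ≤ ε) (x : ℝ) :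
    1 ≤ 1 + ε * V.eval x :=
  le_add_of_nonneg_right (mul_nonneg hε (hV x))

lemma truncPoly_nonneg (hV : ∀ x, 0 ≤ V.eval x) (hε : 0 ≤ ε) (x : ℝ) : 0 ≤ truncPoly V ε x :=
  div_nonneg (hV x) (zero_le_one.trans (one_le_one_add_mul_eval hV hε x))

lemma truncPoly_le (hV : ∀ x, 0 ≤ V.eval x) (hε : 0 ≤ ε) (x : ℝ) : truncPoly V ε x ≤ V.eval x :=
  div_le_self (hV x) (one_le_one_add_mul_eval hV hε x)

lemma abs_truncPoly_le (hV : ∀ x, 0 ≤ V.eval x) (hε : 0 < ε) (x : ℝ) :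
    |truncPoly V ε x| ≤ 1 / ε := by
  rw [abs_of_nonneg (truncPoly_nonneg hV hε.le x), truncPoly,
    div_le_div_iff₀ (zero_lt_one.trans_le (one_le_one_add_mul_eval hV hε.le x)) hε]
  linarith

lemma contDiff_truncPoly (hV : ∀ x, 0 ≤ V.eval x) (hε : 0 ≤ ε) : ContDiff ℝ 2 (truncPoly V ε) :=
  have hc := contDiff_eval V 2
  hc.div (contDiff_const.add (contDiff_const.mul hc)) fun x =>
    (zero_lt_one.trans_le (one_le_one_add_mul_eval hV hε x)).ne'

lemma deriv_truncPoly (hV : ∀ x, 0 ≤ V.eval x) (hε : 0 ≤ ε) :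
    deriv (truncPoly V ε) = fun x => V.derivative.eval x / (1 + ε * V.eval x) ^ 2 := by
  ext x
  have hx := (zero_lt_one.trans_le (one_le_one_add_mul_eval hV hε x)).ne'
  refine ((V.hasDerivAt x).div (((V.hasDerivAt x).const_mul ε).const_add 1) hx).deriv.trans ?_
  ring

lemma deriv_deriv_truncPoly (hV : ∀ x, 0 ≤ V.eval x) (hε : 0 ≤ ε) (x : ℝ) :
    deriv (deriv (truncPoly V ε)) x
      = V.derivative.derivative.eval x / (1 + ε * V.eval x) ^ 2
        - 2 * ε * V.derivative.eval x ^ 2 / (1 + ε * V.eval x) ^ 3 := by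
  have hx := (zero_lt_one.trans_le (one_le_one_add_mul_eval hV hε x)).ne'
  rw [deriv_truncPoly hV hε]
  refine ((V.derivative.hasDerivAt x).fun_div
    ((((V.hasDerivAt x).const_mul ε).const_add 1).fun_pow 2) (pow_ne_zero 2 hx)).deriv.trans ?_
  field_simp
  ring

lemma abs_deriv_truncPoly_le (hV : ∀ x, 0 ≤ V.eval x) (hε : 0 ≤ ε) (x : ℝ) :
    |deriv (truncPoly V ε) x| ≤ |V.derivative.eval x| := by
  have hone := one_le_pow₀ (n := 2) (one_le_one_add_mul_eval hV hε x)
  rw [deriv_truncPoly hV hε, abs_div, abs_of_pos (zero_lt_one.trans_le hone)]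
  exact div_le_self (abs_nonneg _) hone

lemma abs_deriv_deriv_truncPoly_le (hV : ∀ x, 0 ≤ V.eval x) (hε : 0 ≤ ε) (x : ℝ) :
    |deriv (deriv (truncPoly V ε)) x|
      ≤ |V.derivative.derivative.eval x| + 2 * ε * V.derivative.eval x ^ 2 := by
  have hone := one_le_one_add_mul_eval hV hε x
  have hpos := zero_lt_one.trans_le hone
  rw [deriv_deriv_truncPoly hV hε]
  refine (abs_sub _ _).trans ?_
  rw [abs_div, abs_div, abs_of_pos (pow_pos hpos 2), abs_of_pos (pow_pos hpos 3),
    abs_of_nonneg (by positivity : 0 ≤ 2 * ε * V.derivative.eval x ^ 2)]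
  gcongr <;> exact div_le_self (by positivity) (one_le_pow₀ hone)

lemma exists_polyGrowth_truncPoly (hV : ∀ x, 0 ≤ V.eval x) (hε : 0 ≤ ε) :
    ∃ K j, PolyGrowth K j (truncPoly V ε) := by
  obtain ⟨q, h⟩ := exists_abs_eval_le V.derivative
  obtain ⟨q', h'⟩ := exists_abs_eval_le V.derivative.derivative
  have h0 (x : ℝ) := (abs_nonneg _).trans (h x)
  have h0' (x : ℝ) := (abs_nonneg _).trans (h' x)
  have hsq (x : ℝ) : 0 ≤ 2 * ε * V.derivative.eval x ^ 2 := by positivity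
  refine exists_polyGrowth_of_abs_le_eval
    (q := V + q + q' + Polynomial.C (2 * ε) * V.derivative ^ 2) (contDiff_truncPoly hV hε)
    (fun x => ?_) (fun x => ?_) (fun x => ?_) <;>
    simp only [Polynomial.eval_add, Polynomial.eval_mul, Polynomial.eval_pow, Polynomial.eval_C]
  · rw [abs_of_nonneg (truncPoly_nonneg hV hε x)]
    linarith [truncPoly_le hV hε x, h0 x, h0' x, hsq x]
  · linarith [abs_deriv_truncPoly_le hV hε x, h x, hV x, h0' x, hsq x]
  · linarith [abs_deriv_deriv_truncPoly_le hV hε x, h' x, hV x, h0 x]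

end TruncPoly

lemma IsPolynomialOperator.generator_truncPoly_le (hpol : IsPolynomialOperator b σ ℓ) {V : ℝ[X]}
    (hV : ∀ x, 0 ≤ V.eval x) {C : ℝ} (hC : 0 ≤ C)
    (hVC : ∀ x, generator b σ ℓ (fun u => V.eval u) x ≤ C * V.eval x) {ε : ℝ} (hε : 0 < ε)
    (x : ℝ) : generator b σ ℓ (truncPoly V ε) x ≤ C * truncPoly V ε x := by
  obtain ⟨K, j, hf⟩ := exists_polyGrowth_truncPoly hV hε.le
  set a := (1 + ε * V.eval x) ^ 2
  have hone := one_le_one_add_mul_eval hV hε.le x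
  have : 0 < a := pow_pos (zero_lt_one.trans_le hone) 2
  have hd : deriv (truncPoly V ε) x = V.derivative.eval x / a := by rw [deriv_truncPoly hV hε.le]
  have hdd : deriv (deriv (truncPoly V ε)) x ≤ V.derivative.derivative.eval x / a := by
    rw [deriv_deriv_truncPoly hV hε.le]
    exact sub_le_self _ (by positivity)
  have hjump : ∫ z, (truncPoly V ε (x + z) - truncPoly V ε x - deriv (truncPoly V ε) x * z) ∂(ℓ x)
      ≤ (∫ z, (V.eval (x + z) - V.eval x - V.derivative.eval x * z) ∂(ℓ x)) / a := by
    rw [← integral_div]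
    refine integral_mono (hpol.integrable_increment hf x)
      ((hpol.integrable_increment_eval V x).div_const a) fun z => ?_
    have htangent := div_one_add_mul_le_tangent hε (hV x) (hV (x + z))
    simp only [hd, sub_div] at htangent ⊢
    rw [div_mul_eq_mul_div]
    unfold truncPoly
    linarith
  calc generator b σ ℓ (truncPoly V ε) x
      ≤ generator b σ ℓ (fun u => V.eval u) x / a := by
        rw [generator_eval, add_div, add_div, mul_div_assoc, mul_div_assoc]
        unfold generator
        rw [hd] at hjump ⊢
        gcongr
    _ ≤ C * V.eval x / a := by gcongr; exact hVC x
    _ ≤ C * truncPoly V ε x := by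
        rw [mul_div_assoc, truncPoly]
        have hVx := hV x
        gcongr
        exact le_self_pow₀ hone two_ne_zero

/-- The smooth bounded truncation `sin(εx)/ε` of the identity; composing with it turns a function
of polynomial growth into a bounded one with the same growth bounds. -/
def sinTrunc (ε x : ℝ) : ℝ := Real.sin (ε * x) / ε

section SinTrunc

variable {f : ℝ → ℝ} {K : ℝ} {j : ℕ} {ε : ℝ}

lemma abs_sinTrunc_le (hε : 0 < ε) (x : ℝ) : |sinTrunc ε x| ≤ |x| := by
  rw [sinTrunc, abs_div, abs_of_pos hε, div_le_iff₀ hε]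
  calc |Real.sin (ε * x)| ≤ |ε * x| := Real.abs_sin_le_abs
    _ = |x| * ε := by rw [abs_mul, abs_of_pos hε, mul_comm]

lemma abs_sinTrunc_le_inv (hε : 0 < ε) (x : ℝ) : |sinTrunc ε x| ≤ ε⁻¹ := by
  rw [sinTrunc, abs_div, abs_of_pos hε, inv_eq_one_div]
  gcongr
  exact Real.abs_sin_le_one _

lemma contDiff_sinTrunc (ε : ℝ) : ContDiff ℝ 2 (sinTrunc ε) := by
  unfold sinTrunc
  fun_prop

lemma hasDerivAt_sinTrunc (hε : ε ≠ 0) (x : ℝ) :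
    HasDerivAt (sinTrunc ε) (Real.cos (ε * x)) x := by
  refine ((((hasDerivAt_id' x).const_mul ε).sin).div_const ε).congr_deriv ?_
  field_simp

lemma deriv_comp_sinTrunc (hf : ContDiff ℝ 2 f) (hε : ε ≠ 0) :
    deriv (fun u => f (sinTrunc ε u)) = fun x => deriv f (sinTrunc ε x) * Real.cos (ε * x) :=
  funext fun x => ((hf.differentiable two_ne_zero _).hasDerivAt.comp x
    (hasDerivAt_sinTrunc hε x)).deriv

lemma deriv_deriv_comp_sinTrunc (hf : ContDiff ℝ 2 f) (hε : ε ≠ 0) (x : ℝ) :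
    deriv (deriv fun u => f (sinTrunc ε u)) x
      = deriv (deriv f) (sinTrunc ε x) * Real.cos (ε * x) ^ 2
        - deriv f (sinTrunc ε x) * (ε * Real.sin (ε * x)) := by
  rw [deriv_comp_sinTrunc hf hε]
  have hf' := ((contDiff_one_deriv hf).differentiable one_ne_zero (sinTrunc ε x)).hasDerivAt
  refine ((hf'.comp x (hasDerivAt_sinTrunc hε x)).mul
    ((hasDerivAt_id' x).const_mul ε).cos).deriv.trans ?_
  rw [Function.comp_apply]
  ring

namespace PolyGrowth

lemma comp_sinTrunc (hf : PolyGrowth K j f) (hε : 0 < ε) (hε1 : ε ≤ 1) :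
    PolyGrowth (2 * K) j fun u => f (sinTrunc ε u) := by
  have hK := hf.nonneg
  have hle (x : ℝ) : K * (1 + sinTrunc ε x ^ 2) ^ j ≤ K * (1 + x ^ 2) ^ j := by
    gcongr K * (1 + ?_) ^ j
    exact sq_le_sq.2 (abs_sinTrunc_le hε x)
  have hf0 (x : ℝ) := (hf.abs_le _).trans (hle x)
  have hf1 (x : ℝ) := (hf.abs_deriv_le _).trans (hle x)
  have hf2 (x : ℝ) := (hf.abs_deriv_deriv_le _).trans (hle x)
  have hcos (x : ℝ) := Real.abs_cos_le_one (ε * x)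
  have hsin (x : ℝ) : |ε * Real.sin (ε * x)| ≤ 1 := by
    rw [abs_mul, abs_of_pos hε]
    exact mul_le_one₀ hε1 (abs_nonneg _) (Real.abs_sin_le_one _)
  refine ⟨hf.contDiff.comp (contDiff_sinTrunc ε), fun x => ?_, fun x => ?_, fun x => ?_⟩
  · linarith [hf0 x, (abs_nonneg _).trans (hf0 x)]
  · rw [deriv_comp_sinTrunc hf.contDiff hε.ne', abs_mul]
    linarith [mul_le_of_le_one_right (abs_nonneg (deriv f (sinTrunc ε x))) (hcos x), hf1 x,
      (abs_nonneg _).trans (hf0 x)]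
  · rw [deriv_deriv_comp_sinTrunc hf.contDiff hε.ne']
    refine (abs_sub _ _).trans ?_
    rw [abs_mul, abs_mul, abs_pow]
    linarith [mul_le_of_le_one_right (abs_nonneg (deriv (deriv f) (sinTrunc ε x)))
      (pow_le_one₀ (n := 2) (abs_nonneg _) (hcos x)), hf2 x,
      mul_le_of_le_one_right (abs_nonneg (deriv f (sinTrunc ε x))) (hsin x), hf1 x]

lemma abs_comp_sinTrunc_le (hf : PolyGrowth K j f) (hε : 0 < ε) (x : ℝ) :
    |f (sinTrunc ε x)| ≤ K * (1 + ε⁻¹ ^ 2) ^ j := by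
  have hK := hf.nonneg
  refine (hf.abs_le _).trans ?_
  gcongr K * (1 + ?_) ^ j
  exact sq_le_sq.2 ((abs_sinTrunc_le_inv hε x).trans (le_abs_self _))

end PolyGrowth

lemma tendsto_sinTrunc (x : ℝ) : Tendsto (fun ε => sinTrunc ε x) (𝓝[>] 0) (𝓝 x) := by
  have h : HasDerivAt (fun t => Real.sin (t * x)) x 0 := by
    simpa using ((hasDerivAt_id (0 : ℝ)).mul_const x).sin
  refine h.tendsto_slope_zero_right.congr fun ε => ?_
  simp [sinTrunc, div_eq_inv_mul]

lemma tendsto_deriv_comp_sinTrunc (hf : ContDiff ℝ 2 f) (x : ℝ) :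
    Tendsto (fun ε => deriv (fun u => f (sinTrunc ε u)) x) (𝓝[>] 0) (𝓝 (deriv f x)) := by
  have hcos : Tendsto (fun ε => Real.cos (ε * x)) (𝓝[>] 0) (𝓝 1) :=
    tendsto_nhdsWithin_of_tendsto_nhds (Continuous.tendsto' (by fun_prop) _ _ (by simp))
  have hf' := ((contDiff_one_deriv hf).continuous.tendsto x).comp (tendsto_sinTrunc x)
  rw [← mul_one (deriv f x)]
  refine (hf'.mul hcos).congr' ?_
  filter_upwards [self_mem_nhdsWithin] with ε hε
  rw [deriv_comp_sinTrunc hf (ne_of_gt hε)]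
  rfl

lemma tendsto_deriv_deriv_comp_sinTrunc (hf : ContDiff ℝ 2 f) (x : ℝ) :
    Tendsto (fun ε => deriv (deriv fun u => f (sinTrunc ε u)) x) (𝓝[>] 0)
      (𝓝 (deriv (deriv f) x)) := by
  have hcos : Tendsto (fun ε => Real.cos (ε * x) ^ 2) (𝓝[>] 0) (𝓝 1) :=
    tendsto_nhdsWithin_of_tendsto_nhds (Continuous.tendsto' (by fun_prop) _ _ (by simp))
  have hsin : Tendsto (fun ε => ε * Real.sin (ε * x)) (𝓝[>] 0) (𝓝 0) :=
    tendsto_nhdsWithin_of_tendsto_nhds (Continuous.tendsto' (by fun_prop) _ _ (by simp))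
  have hf' := ((contDiff_one_deriv hf).continuous.tendsto x).comp (tendsto_sinTrunc x)
  have hf'' := (((contDiff_one_deriv hf).continuous_deriv le_rfl).tendsto x).comp
    (tendsto_sinTrunc x)
  have hlim := (hf''.mul hcos).sub (hf'.mul hsin)
  rw [mul_one, mul_zero, sub_zero] at hlim
  refine hlim.congr' ?_
  filter_upwards [self_mem_nhdsWithin] with ε hε
  rw [deriv_deriv_comp_sinTrunc hf (ne_of_gt hε)]
  rfl

lemma IsPolynomialOperator.tendsto_generator_comp_sinTrunc (hpol : IsPolynomialOperator b σ ℓ)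
    (hf : PolyGrowth K j f) (x : ℝ) :
    Tendsto (fun ε => generator b σ ℓ (fun u => f (sinTrunc ε u)) x) (𝓝[>] 0)
      (𝓝 (generator b σ ℓ f x)) := by
  have hlim (z : ℝ) : Tendsto (fun ε => f (sinTrunc ε z)) (𝓝[>] 0) (𝓝 (f z)) :=
    (hf.contDiff.continuous.tendsto z).comp (tendsto_sinTrunc z)
  have hlim' := tendsto_deriv_comp_sinTrunc hf.contDiff x
  have hgrowth : ∀ᶠ ε in 𝓝[>] 0, PolyGrowth (2 * K) j fun u => f (sinTrunc ε u) := by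
    filter_upwards [Ioc_mem_nhdsGT zero_lt_one] with ε hε using hf.comp_sinTrunc hε.1 hε.2
  have hjump : Tendsto (fun ε => ∫ z, (f (sinTrunc ε (x + z)) - f (sinTrunc ε x)
      - deriv (fun u => f (sinTrunc ε u)) x * z) ∂(ℓ x)) (𝓝[>] 0)
      (𝓝 (∫ z, (f (x + z) - f x - deriv f x * z) ∂(ℓ x))) := by
    refine tendsto_integral_filter_of_dominated_convergence _
      (hgrowth.mono fun ε hε => (hpol.integrable_increment hε x).aestronglyMeasurable)
      (hgrowth.mono fun ε hε => ae_of_all _ (hε.abs_increment_le x))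
      ((hpol.integrable_weight j x).const_mul _) (ae_of_all _ fun z => ?_)
    exact ((hlim (x + z)).sub (hlim x)).sub (hlim'.mul_const z)
  exact ((hlim'.const_mul (b x)).add
    ((tendsto_deriv_deriv_comp_sinTrunc hf.contDiff x).const_mul _)).add hjump

end SinTrunc

end Truncation

/-! ### Càdlàg paths -/

section RightContinuous

variable {Ω : Type*} {mΩ : MeasurableSpace Ω}

/-- The first point of the grid `{1/(n+1), 2/(n+1), …}` strictly after `u`, used to approximate a
right-continuous process by processes with countably many time values. -/
def nextGridPoint (n : ℕ) (u : ℝ≥0) : ℝ≥0 :=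
  (⌊((n : ℝ≥0) + 1) * u⌋₊ + 1) / ((n : ℝ≥0) + 1)

lemma le_nextGridPoint (n : ℕ) (u : ℝ≥0) : u ≤ nextGridPoint n u := by
  rw [nextGridPoint, le_div_iff₀ (by positivity), mul_comm]
  exact (Nat.lt_floor_add_one _).le

lemma nextGridPoint_le (n : ℕ) (u : ℝ≥0) : nextGridPoint n u ≤ u + 1 / ((n : ℝ≥0) + 1) := by
  rw [nextGridPoint, div_le_iff₀ (by positivity), add_mul u,
    div_mul_cancel₀ _ (by positivity), mul_comm u]
  gcongr
  exact Nat.floor_le (by positivity)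

lemma tendsto_nextGridPoint (u : ℝ≥0) :
    Tendsto (fun n => nextGridPoint n u) atTop (𝓝[≥] u) := by
  have hupper : Tendsto (fun n : ℕ => u + 1 / ((n : ℝ≥0) + 1)) atTop (𝓝 u) := by
    simpa using (tendsto_one_div_add_atTop_nhds_zero_nat (𝕜 := ℝ≥0)).const_add u
  exact tendsto_nhdsWithin_iff.2 ⟨tendsto_of_tendsto_of_tendsto_of_le_of_le tendsto_const_nhds
    hupper (le_nextGridPoint · u) (nextGridPoint_le · u),
    Eventually.of_forall (le_nextGridPoint · u)⟩

lemma measurable_comp_of_countable {Y : ℝ≥0 → Ω → ℝ} (hm : ∀ t, Measurable (Y t)) (c : ℕ → ℝ≥0)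
    {N : ℝ≥0 → ℕ} (hN : Measurable N) : Measurable fun q : ℝ≥0 × Ω => Y (c (N q.1)) q.2 := by
  have hY : Measurable fun q : ℕ × Ω => Y (c q.1) q.2 :=
    measurable_from_prod_countable_right fun k => hm (c k)
  exact hY.comp ((hN.comp measurable_fst).prodMk measurable_snd)

lemma measurable_uncurry_of_rightContinuous {Y : ℝ≥0 → Ω → ℝ} (hm : ∀ t, Measurable (Y t))
    (hc : ∀ ω t, ContinuousWithinAt (fun u => Y u ω) (Set.Ici t) t) :
    Measurable fun q : ℝ≥0 × Ω => Y q.1 q.2 := by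
  have hgrid (n : ℕ) : Measurable fun q : ℝ≥0 × Ω => Y (nextGridPoint n q.1) q.2 :=
    measurable_comp_of_countable hm (fun k : ℕ => ((k : ℝ≥0) + 1) / ((n : ℝ≥0) + 1))
      (N := fun u => ⌊((n : ℝ≥0) + 1) * u⌋₊) (Nat.measurable_floor.comp (measurable_id.const_mul _))
  exact measurable_of_tendsto_metrizable hgrid
    (tendsto_pi_nhds.2 fun q => (hc q.2 q.1).tendsto.comp (tendsto_nextGridPoint q.1))

end RightContinuous

lemma exists_bound_of_cadlag {g : ℝ≥0 → ℝ} (hr : ∀ t, ContinuousWithinAt g (Set.Ici t) t)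
    (hl : ∀ t, ∃ l : ℝ, Tendsto g (𝓝[<] t) (𝓝 l)) (T : ℝ≥0) :
    ∃ R, ∀ u ≤ T, |g u| ≤ R := by
  suffices h : ∃ R, ∀ u ∈ Set.Icc 0 T, |g u| ≤ R from
    h.imp fun R hR u hu => hR u ⟨zero_le, hu⟩
  refine isCompact_Icc.induction_on (p := fun s => ∃ R, ∀ u ∈ s, |g u| ≤ R) ⟨0, by simp⟩
    (fun s t hst ⟨R, hR⟩ => ⟨R, fun u hu => hR u (hst hu)⟩)
    (fun s t ⟨R, hR⟩ ⟨R', hR'⟩ => ⟨max R R', ?_⟩) fun t _ => ?_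
  · rintro u (hu | hu)
    · exact (hR u hu).trans (le_max_left _ _)
    · exact (hR' u hu).trans (le_max_right _ _)
  · obtain ⟨l, hl⟩ := hl t
    have hleft : ∀ᶠ u in 𝓝[<] t, |g u| < max |l| |g t| + 1 :=
      hl.abs.eventually_lt_const ((le_max_left _ _).trans_lt (lt_add_one _))
    have hright : ∀ᶠ u in 𝓝[≥] t, |g u| < max |l| |g t| + 1 :=
      (hr t).tendsto.abs.eventually_lt_const ((le_max_right _ _).trans_lt (lt_add_one _))
    refine ⟨{u | |g u| < max |l| |g t| + 1}, mem_nhdsWithin_of_mem_nhds ?_, _, fun u hu => hu.le⟩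
    rw [← nhdsLT_sup_nhdsGE]
    exact ⟨hleft, hright⟩

/-! ### Local martingales -/

section LocalMartingale

variable {Ω : Type*} {mΩ : MeasurableSpace Ω} {P : Measure Ω} {𝓕 : Filtration ℝ≥0 mΩ}
  {M : ℝ≥0 → Ω → ℝ} {t : ℝ≥0} {ω : Ω}

lemma exists_stoppedProcess_eq (M : ℝ≥0 → Ω → ℝ) (τ : Ω → WithTop ℝ≥0) (t : ℝ≥0) (ω : Ω) :
    ∃ u ≤ t, stoppedProcess (fun i => {ω | ⊥ < τ ω}.indicator (M i)) τ t ω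
      = {ω | ⊥ < τ ω}.indicator (M u) ω := by
  refine ⟨(min (t : WithTop ℝ≥0) (τ ω)).untopA, ?_, rfl⟩
  cases h : τ ω with
  | top => rw [min_eq_left le_top]; exact le_rfl
  | coe a => rw [← WithTop.coe_min]; exact min_le_left t a

lemma stoppedProcess_eq_of_lt {τ : Ω → WithTop ℝ≥0} (h : (t : WithTop ℝ≥0) < τ ω) :
    stoppedProcess (fun i => {ω | ⊥ < τ ω}.indicator (M i)) τ t ω = M t ω := by
  simp only [stoppedProcess, min_eq_left h.le]
  exact Set.indicator_of_mem (s := {ω | ⊥ < τ ω}) (lt_of_le_of_lt bot_le h) (M t)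

lemma tendsto_stoppedProcess {τ : ℕ → Ω → WithTop ℝ≥0} (h : Tendsto (τ · ω) atTop (𝓝 ⊤)) :
    Tendsto (fun n => stoppedProcess (fun i => {ω | ⊥ < τ n ω}.indicator (M i)) (τ n) t ω) atTop
      (𝓝 (M t ω)) :=
  tendsto_const_nhds.congr' ((h.eventually (lt_mem_nhds (WithTop.coe_lt_top t))).mono
    fun _ hn => (stoppedProcess_eq_of_lt hn).symm)

namespace IsLocalMartingale

lemma setIntegral_eq [IsFiniteMeasure P] (hM : IsLocalMartingale M 𝓕 P) {s : ℝ≥0} (hst : s ≤ t)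
    {g : Ω → ℝ} (hg : Integrable g P) (hMg : ∀ ω, ∀ u ≤ t, |M u ω| ≤ g ω) {A : Set Ω}
    (hA : MeasurableSet[𝓕 s] A) : ∫ ω in A, M t ω ∂P = ∫ ω in A, M s ω ∂P := by
  obtain ⟨τ, hτ, hN⟩ := hM
  have hlim (v : ℝ≥0) (hv : v ≤ t) : Tendsto (fun n => ∫ ω in A,
      stoppedProcess (fun i => {ω | ⊥ < τ n ω}.indicator (M i)) (τ n) v ω ∂P) atTop
      (𝓝 (∫ ω in A, M v ω ∂P)) := by
    refine tendsto_integral_of_dominated_convergence g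
      (fun n => ((hN n).integrable v).aestronglyMeasurable.restrict) hg.restrict
      (fun n => ae_of_all _ fun ω => ?_) (ae_restrict_of_ae ?_)
    · obtain ⟨u, hu, h⟩ := exists_stoppedProcess_eq M (τ n) v ω
      rw [h]
      exact (norm_indicator_le_norm_self _ _).trans (hMg ω u (hu.trans hv))
    · filter_upwards [hτ.tendsto_top] with ω hω using tendsto_stoppedProcess hω
  exact tendsto_nhds_unique (hlim t le_rfl)
    ((hlim s hst).congr fun n => (hN n).setIntegral_eq hst hA)

lemma aestronglyMeasurable (hM : IsLocalMartingale M 𝓕 P) (t : ℝ≥0) :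
    AEStronglyMeasurable (M t) P := by
  obtain ⟨τ, hτ, hN⟩ := hM
  exact aestronglyMeasurable_of_tendsto_ae atTop
    (fun n => ((hN n).integrable t).aestronglyMeasurable)
    (hτ.tendsto_top.mono fun _ hω => tendsto_stoppedProcess hω)

lemma integral_min_const_nonpos [IsProbabilityMeasure P] (hM : IsLocalMartingale M 𝓕 P)
    (hM0 : ∀ᵐ ω ∂P, M 0 ω = 0) {c : ℝ} (hc : 0 ≤ c) (hMc : ∀ ω, ∀ u ≤ t, -c ≤ M u ω) :
    ∫ ω, min (M t ω) c ∂P ≤ 0 := by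
  obtain ⟨τ, hτ, hN⟩ := hM
  set N := fun n => stoppedProcess (fun i => {ω | ⊥ < τ n ω}.indicator (M i)) (τ n)
  have hNc (n : ℕ) (ω : Ω) : -c ≤ N n t ω := by
    obtain ⟨u, hu, h⟩ := exists_stoppedProcess_eq M (τ n) t ω
    simp only [N, h, Set.indicator_apply]
    split_ifs
    exacts [hMc ω u hu, neg_nonpos.2 hc]
  have hN0 (n : ℕ) : N n 0 =ᵐ[P] 0 := by
    filter_upwards [hM0] with ω hω
    obtain ⟨u, hu, h⟩ := exists_stoppedProcess_eq M (τ n) 0 ω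
    simp only [N, h, nonpos_iff_eq_zero.1 hu, Set.indicator_apply, hω, ite_self, Pi.zero_apply]
  have hNint (n : ℕ) : ∫ ω, N n t ω ∂P = 0 := by
    have h := (hN n).setIntegral_eq (zero_le (a := t)) MeasurableSet.univ
    rw [setIntegral_univ, setIntegral_univ] at h
    exact h.symm.trans (integral_eq_zero_of_ae (hN0 n))
  have hlim : Tendsto (fun n => ∫ ω, min (N n t ω) c ∂P) atTop (𝓝 (∫ ω, min (M t ω) c ∂P)) := by
    refine tendsto_integral_of_dominated_convergence (fun _ => c)
      (fun n => (((hN n).integrable t).inf (integrable_const c)).aestronglyMeasurable)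
      (integrable_const c)
      (fun n => ae_of_all _ fun ω => abs_le.2 ⟨le_min (hNc n ω) (by linarith), min_le_right _ _⟩) ?_
    filter_upwards [hτ.tendsto_top] with ω hω
    exact (tendsto_stoppedProcess hω).min tendsto_const_nhds
  refine le_of_tendsto' hlim fun n => ?_
  calc ∫ ω, min (N n t ω) c ∂P ≤ ∫ ω, N n t ω ∂P :=
        integral_mono (((hN n).integrable t).inf (integrable_const c)) ((hN n).integrable t)
          fun ω => min_le_left _ _
    _ = 0 := hNint n

lemma integral_nonpos_of_le [IsProbabilityMeasure P] (hM : IsLocalMartingale M 𝓕 P)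
    (hM0 : ∀ᵐ ω ∂P, M 0 ω = 0) {c : ℝ} (hc : 0 ≤ c) (hMc : ∀ ω, ∀ u ≤ t, -c ≤ M u ω) {L : Ω → ℝ}
    (hL : Integrable L P) (hLc : ∀ ω, L ω ≤ c) (hLM : ∀ ω, L ω ≤ M t ω) : ∫ ω, L ω ∂P ≤ 0 := by
  have hmin : Integrable (fun ω => min (M t ω) c) P :=
    Integrable.of_bound ((hM.aestronglyMeasurable t).inf aestronglyMeasurable_const) c
      (ae_of_all _ fun ω => abs_le.2
        ⟨le_min (hMc ω t le_rfl) ((neg_nonpos.2 hc).trans hc), min_le_right _ _⟩)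
  exact (integral_mono hL hmin fun ω => le_min (hLM ω) (hLc ω)).trans
    (hM.integral_min_const_nonpos hM0 hc hMc)

end IsLocalMartingale

end LocalMartingale

/-! ### Moments of polynomial jump-diffusions -/

section Moments

variable {b σ : ℝ → ℝ} {ℓ : Kernel ℝ ℝ} {Ω : Type*} {mΩ : MeasurableSpace Ω} {P : Measure Ω}
  {𝓕 : Filtration ℝ≥0 mΩ} {y : ℝ} {Y : ℝ≥0 → Ω → ℝ} {f g : ℝ → ℝ} {q : ℝ[X]} {K : ℝ} {j : ℕ}

lemma IsPolynomialOperator.exists_abs_generator_le_eval (hpol : IsPolynomialOperator b σ ℓ)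
    (hf : PolyGrowth K j f) : ∃ q : ℝ[X], ∀ x, |generator b σ ℓ f x| ≤ q.eval x := by
  obtain ⟨q, hq⟩ := hpol.exists_abs_generator_le j
  exact ⟨Polynomial.C K * q, fun x => by simpa using hq f K hf x⟩

lemma PolyGrowth.exists_abs_le_eval (hf : PolyGrowth K j f) :
    ∃ q : ℝ[X], ∀ x, |f x| ≤ q.eval x :=
  ⟨Polynomial.C K * (1 + Polynomial.X ^ 2) ^ j, fun x => by simpa using hf.abs_le x⟩

lemma tendsto_truncPoly (V : ℝ[X]) (x : ℝ) :
    Tendsto (fun ε => truncPoly V ε x) (𝓝 0) (𝓝 (V.eval x)) := by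
  have : ContinuousAt (fun ε : ℝ => V.eval x / (1 + ε * V.eval x)) 0 := by
    fun_prop (disch := simp)
  simpa [ContinuousAt, truncPoly] using this

namespace IsJumpDiffusion

lemma measurable (hY : IsJumpDiffusion b σ ℓ 𝓕 P y Y) (t : ℝ≥0) : Measurable (Y t) :=
  ((hY.adapted t).mono (𝓕.le t)).measurable

lemma measurable_uncurry (hY : IsJumpDiffusion b σ ℓ 𝓕 P y Y) :
    Measurable fun p : ℝ × Ω => Y p.1.toNNReal p.2 :=
  (measurable_uncurry_of_rightContinuous hY.measurable hY.right_continuous).comp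
    ((measurable_real_toNNReal.comp measurable_fst).prodMk measurable_snd)

lemma continuousWithinAt_toNNReal (hY : IsJumpDiffusion b σ ℓ 𝓕 P y Y) (ω : Ω) (u : ℝ) :
    ContinuousWithinAt (fun v : ℝ => Y v.toNNReal ω) (Set.Ici u) u :=
  (hY.right_continuous ω u.toNNReal).comp continuous_real_toNNReal.continuousWithinAt
    fun _ hv => Real.toNNReal_le_toNNReal hv

lemma intervalIntegrable_comp (hY : IsJumpDiffusion b σ ℓ 𝓕 P y Y) (hg : Measurable g)
    (hgq : ∀ x, |g x| ≤ q.eval x) (ω : Ω) (s t : ℝ) :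
    IntervalIntegrable (fun u : ℝ => g (Y u.toNNReal ω)) volume s t := by
  obtain ⟨R, hR⟩ := exists_bound_of_cadlag (hY.right_continuous ω) (hY.left_limits ω)
    (max s t).toNNReal
  obtain ⟨C, hC⟩ := isCompact_Icc.exists_bound_of_continuousOn (s := Set.Icc (-R) R)
    q.continuous.continuousOn
  rw [intervalIntegrable_iff]
  refine Measure.integrableOn_of_bounded (M := C) (by simp)
    (hg.comp (hY.measurable_uncurry.comp measurable_prodMk_right)).aestronglyMeasurable ?_
  refine (ae_restrict_iff' measurableSet_uIoc).2 (ae_of_all _ fun u hu => ?_)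
  exact (hgq _).trans ((le_abs_self _).trans
    (hC _ (abs_le.1 (hR _ (Real.toNNReal_le_toNNReal hu.2)))))

section Lyapunov

variable {B C : ℝ}

lemma integrable_prod_comp_of_bounded [IsFiniteMeasure P] (hY : IsJumpDiffusion b σ ℓ 𝓕 P y Y)
    (hg : Measurable g) (hB : ∀ x, |g x| ≤ B) (s t : ℝ) :
    Integrable (fun p : ℝ × Ω => g (Y p.1.toNNReal p.2))
      ((volume.restrict (Set.Ioc s t)).prod P) :=
  Integrable.of_bound (hg.comp hY.measurable_uncurry).aestronglyMeasurable B
    (ae_of_all _ fun _ => hB _)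

lemma integral_generator_comp_le (hY : IsJumpDiffusion b σ ℓ 𝓕 P y Y)
    (hop : IsJumpDiffusionOperator b σ ℓ) (hpol : IsPolynomialOperator b σ ℓ)
    (hf : PolyGrowth K j f) (hfC : ∀ x, generator b σ ℓ f x ≤ C * f x) (ω : Ω) (t : ℝ≥0) :
    ∫ u in (0 : ℝ)..t, generator b σ ℓ f (Y u.toNNReal ω)
      ≤ C * ∫ u in (0 : ℝ)..t, f (Y u.toNNReal ω) := by
  have hfm : Measurable f := hf.contDiff.continuous.measurable
  obtain ⟨q, hq⟩ := hpol.exists_abs_generator_le_eval hf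
  obtain ⟨q', hq'⟩ := hf.exists_abs_le_eval
  rw [← intervalIntegral.integral_const_mul]
  exact intervalIntegral.integral_mono_on t.2
    (hY.intervalIntegrable_comp (hpol.measurable_generator hop hfm) hq ω _ _)
    ((hY.intervalIntegrable_comp hfm hq' ω _ _).const_mul C) fun u _ => hfC _

lemma integral_comp_le_add_mul_integral [IsProbabilityMeasure P]
    (hY : IsJumpDiffusion b σ ℓ 𝓕 P y Y) (hop : IsJumpDiffusionOperator b σ ℓ)
    (hpol : IsPolynomialOperator b σ ℓ) (hf : PolyGrowth K j f) (hf0 : ∀ x, 0 ≤ f x)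
    (hB : ∀ x, |f x| ≤ B) (hC : 0 ≤ C) (hfC : ∀ x, generator b σ ℓ f x ≤ C * f x) (t : ℝ≥0) :
    ∫ ω, f (Y t ω) ∂P ≤ f y + C * ∫ u in (0 : ℝ)..t, ∫ ω, f (Y u.toNNReal ω) ∂P := by
  have hfm : Measurable f := hf.contDiff.continuous.measurable
  have hfB (x : ℝ) : f x ≤ B := (le_abs_self _).trans (hB x)
  have hB0 : 0 ≤ B := (hf0 0).trans (hfB 0)
  let F (u : ℝ≥0) (ω : Ω) : ℝ := ∫ v in (0 : ℝ)..u, f (Y v.toNNReal ω)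
  have hF0 (u : ℝ≥0) (ω : Ω) : 0 ≤ C * F u ω :=
    mul_nonneg hC (intervalIntegral.integral_nonneg u.2 fun _ _ => hf0 _)
  have hF (ω : Ω) (u : ℝ≥0) (hu : u ≤ t) : C * F u ω ≤ C * (B * t) := by
    have : ‖F u ω‖ ≤ B * |(u : ℝ) - 0| :=
      intervalIntegral.norm_integral_le_of_norm_le_const fun v _ => hB _
    rw [sub_zero, NNReal.abs_eq] at this
    exact mul_le_mul_of_nonneg_left ((le_abs_self _).trans (this.trans (by gcongr))) hC
  have hFM (ω : Ω) (u : ℝ≥0) := hY.integral_generator_comp_le hop hpol hf hfC ω u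
  have hprod := hY.integrable_prod_comp_of_bounded hfm hB 0 t
  have hft : Integrable (fun ω => f (Y t ω)) P :=
    Integrable.of_bound (hfm.comp (hY.measurable t)).aestronglyMeasurable B
      (ae_of_all _ fun _ => hB _)
  have hft' : Integrable (fun ω => f (Y t ω) - f y) P := hft.sub (integrable_const _)
  have hFt : Integrable (fun ω => C * F t ω) P := by
    simp only [F, intervalIntegral.integral_of_le t.coe_nonneg]
    exact hprod.integral_prod_right.const_mul C
  have hL : ∫ ω, (f (Y t ω) - f y - C * F t ω) ∂P ≤ 0 :=
    (hY.martingale_problem f hf.contDiff ⟨B, hB⟩).integral_nonpos_of_le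
      (hY.initial.mono fun ω hω => by simp [hω]) (c := B + C * (B * t)) (by positivity)
      (fun ω u hu => by linarith [hF ω u hu, hFM ω u, hfB y, hf0 (Y u ω)]) (hft'.sub hFt)
      (fun ω => by linarith [hF0 t ω, hfB (Y t ω), hf0 y, hF ω t le_rfl])
      fun ω => by linarith [hFM ω t]
  have hswap : ∫ ω, F t ω ∂P = ∫ u in (0 : ℝ)..t, ∫ ω, f (Y u.toNNReal ω) ∂P :=
    (intervalIntegral_integral_swap (by rwa [Set.uIoc_of_le t.coe_nonneg])).symm
  rw [integral_sub hft' hFt, integral_const_mul, hswap, integral_sub hft (integrable_const _)] at hL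
  simpa [sub_nonpos, add_comm] using hL

lemma integral_comp_le_mul_exp [IsProbabilityMeasure P]
    (hY : IsJumpDiffusion b σ ℓ 𝓕 P y Y) (hop : IsJumpDiffusionOperator b σ ℓ)
    (hpol : IsPolynomialOperator b σ ℓ) (hf : PolyGrowth K j f) (hf0 : ∀ x, 0 ≤ f x)
    (hB : ∀ x, |f x| ≤ B) (hC : 0 ≤ C) (hfC : ∀ x, generator b σ ℓ f x ≤ C * f x) (t : ℝ≥0) :
    ∫ ω, f (Y t ω) ∂P ≤ f y * Real.exp (C * t) := by
  have hfc : Continuous f := hf.contDiff.continuous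
  have hint : IntervalIntegrable (fun u : ℝ => ∫ ω, f (Y u.toNNReal ω) ∂P) volume 0 t := by
    rw [intervalIntegrable_iff, Set.uIoc_of_le t.coe_nonneg]
    exact (hY.integrable_prod_comp_of_bounded hfc.measurable hB 0 t).integral_prod_left
  have hcont (u : ℝ) :
      ContinuousWithinAt (fun u : ℝ => ∫ ω, f (Y u.toNNReal ω) ∂P) (Set.Ici u) u :=
    continuousWithinAt_of_dominated (bound := fun _ => B)
      (.of_forall fun v => (hfc.measurable.comp (hY.measurable _)).aestronglyMeasurable)
      (.of_forall fun _ => ae_of_all _ fun _ => hB _) (integrable_const B)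
      (ae_of_all _ fun ω => hfc.continuousAt.comp_continuousWithinAt
        (hY.continuousWithinAt_toNNReal ω u))
  have h := le_mul_exp_of_le_add_mul_integral hC hint (fun u _ => hcont u) (a := f y)
    (fun u hu => by
      lift u to ℝ≥0 using hu.1
      simpa using hY.integral_comp_le_add_mul_integral hop hpol hf hf0 hB hC hfC u)
    t ⟨t.2, le_rfl⟩
  simpa using h

lemma lintegral_eval_le_mul_exp [IsProbabilityMeasure P]
    (hY : IsJumpDiffusion b σ ℓ 𝓕 P y Y) (hop : IsJumpDiffusionOperator b σ ℓ)
    (hpol : IsPolynomialOperator b σ ℓ) {V : ℝ[X]} (hV : ∀ x, 0 ≤ V.eval x) (hC : 0 ≤ C)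
    (hVC : ∀ x, generator b σ ℓ (fun u => V.eval u) x ≤ C * V.eval x) (t : ℝ≥0) :
    ∫⁻ ω, ENNReal.ofReal (V.eval (Y t ω)) ∂P ≤ ENNReal.ofReal (V.eval y * Real.exp (C * t)) := by
  let ε (N : ℕ) : ℝ := 1 / ((N : ℝ) + 1)
  have hε (N : ℕ) : 0 < ε N := Nat.one_div_pos_of_nat
  have hm (N : ℕ) : Measurable fun ω => truncPoly V (ε N) (Y t ω) :=
    (contDiff_truncPoly hV (hε N).le).continuous.measurable.comp (hY.measurable t)
  have htrunc (N : ℕ) : ∫⁻ ω, ENNReal.ofReal (truncPoly V (ε N) (Y t ω)) ∂P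
      ≤ ENNReal.ofReal (V.eval y * Real.exp (C * t)) := by
    obtain ⟨K, j, hf⟩ := exists_polyGrowth_truncPoly hV (hε N).le
    rw [← ofReal_integral_eq_lintegral_ofReal
      (.of_bound (hm N).aestronglyMeasurable (1 / ε N)
        (ae_of_all _ fun _ => abs_truncPoly_le hV (hε N) _))
      (ae_of_all _ fun _ => truncPoly_nonneg hV (hε N).le _)]
    refine ENNReal.ofReal_le_ofReal ((hY.integral_comp_le_mul_exp hop hpol hf
      (truncPoly_nonneg hV (hε N).le) (abs_truncPoly_le hV (hε N)) hC
      (hpol.generator_truncPoly_le hV hC hVC (hε N)) t).trans ?_)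
    gcongr
    exact truncPoly_le hV (hε N).le y
  calc ∫⁻ ω, ENNReal.ofReal (V.eval (Y t ω)) ∂P
      = ∫⁻ ω, liminf (fun N => ENNReal.ofReal (truncPoly V (ε N) (Y t ω))) atTop ∂P :=
        lintegral_congr fun ω => (ENNReal.tendsto_ofReal ((tendsto_truncPoly V _).comp
          tendsto_one_div_add_atTop_nhds_zero_nat)).liminf_eq.symm
    _ ≤ liminf (fun N => ∫⁻ ω, ENNReal.ofReal (truncPoly V (ε N) (Y t ω)) ∂P) atTop :=
        lintegral_liminf_le fun N => (hm N).ennreal_ofReal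
    _ ≤ ENNReal.ofReal (V.eval y * Real.exp (C * t)) :=
        liminf_le_of_le (by isBoundedDefault) fun a ha =>
          let ⟨N, hN⟩ := ha.exists; hN.trans (htrunc N)

end Lyapunov

lemma exists_lintegral_comp_le [IsProbabilityMeasure P] (hY : IsJumpDiffusion b σ ℓ 𝓕 P y Y)
    (hop : IsJumpDiffusionOperator b σ ℓ) (hpol : IsPolynomialOperator b σ ℓ)
    (hgq : ∀ x, |g x| ≤ q.eval x) (T : ℝ≥0) :
    ∃ B : ℝ≥0, ∀ t ≤ T, ∫⁻ ω, ‖g (Y t ω)‖ₑ ∂P ≤ B := by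
  let k := q.natDegree
  let V : ℝ[X] := (1 + Polynomial.X ^ 2) ^ k
  have hVe (x : ℝ) : V.eval x = (1 + x ^ 2) ^ k := by simp [V]
  have hV (x : ℝ) : 0 ≤ V.eval x := by rw [hVe]; positivity
  obtain ⟨p, hp, hVp⟩ := hpol.map_degree_le (2 * k) V (by dsimp only [V]; compute_degree; lia)
  let C := ∑ i ∈ Finset.range (2 * k + 1), |p.coeff i|
  have hVC (x : ℝ) : generator b σ ℓ (fun u => V.eval u) x ≤ C * V.eval x := by
    rw [hVp, hVe]
    exact (le_abs_self _).trans (abs_eval_le p hp x)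
  let A := ∑ i ∈ Finset.range (2 * k + 1), |q.coeff i|
  have hgV (x : ℝ) : |g x| ≤ A * V.eval x := by
    rw [hVe]
    exact (hgq x).trans ((le_abs_self _).trans (abs_eval_le q (Nat.le_mul_of_pos_left _ two_pos) x))
  refine ⟨(A * (V.eval y * Real.exp (C * T))).toNNReal, fun t ht => ?_⟩
  calc ∫⁻ ω, ‖g (Y t ω)‖ₑ ∂P
      ≤ ∫⁻ ω, ENNReal.ofReal A * ENNReal.ofReal (V.eval (Y t ω)) ∂P := by
        refine lintegral_mono fun ω => ?_
        rw [← ofReal_norm, ← ENNReal.ofReal_mul (by positivity)]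
        exact ENNReal.ofReal_le_ofReal (hgV _)
    _ = ENNReal.ofReal A * ∫⁻ ω, ENNReal.ofReal (V.eval (Y t ω)) ∂P :=
        lintegral_const_mul' _ _ ENNReal.ofReal_ne_top
    _ ≤ ENNReal.ofReal A * ENNReal.ofReal (V.eval y * Real.exp (C * T)) := by
        gcongr
        refine (hY.lintegral_eval_le_mul_exp hop hpol hV (by positivity) hVC t).trans ?_
        gcongr
        exact hV y
    _ = _ := (ENNReal.ofReal_mul (by positivity)).symm

lemma integrable_comp [IsProbabilityMeasure P] (hY : IsJumpDiffusion b σ ℓ 𝓕 P y Y)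
    (hop : IsJumpDiffusionOperator b σ ℓ) (hpol : IsPolynomialOperator b σ ℓ)
    (hg : Measurable g) (hgq : ∀ x, |g x| ≤ q.eval x) (t : ℝ≥0) :
    Integrable (fun ω => g (Y t ω)) P := by
  obtain ⟨B, hB⟩ := hY.exists_lintegral_comp_le hop hpol hgq t
  exact ⟨(hg.comp (hY.measurable t)).aestronglyMeasurable,
    (hB t le_rfl).trans_lt ENNReal.coe_lt_top⟩

lemma integrable_prod_comp [IsProbabilityMeasure P] (hY : IsJumpDiffusion b σ ℓ 𝓕 P y Y)
    (hop : IsJumpDiffusionOperator b σ ℓ) (hpol : IsPolynomialOperator b σ ℓ)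
    (hg : Measurable g) (hgq : ∀ x, |g x| ≤ q.eval x) (s t : ℝ) :
    Integrable (fun p : ℝ × Ω => g (Y p.1.toNNReal p.2))
      ((volume.restrict (Set.Ioc s t)).prod P) := by
  obtain ⟨B, hB⟩ := hY.exists_lintegral_comp_le hop hpol hgq t.toNNReal
  have hm : Measurable fun p : ℝ × Ω => g (Y p.1.toNNReal p.2) := hg.comp hY.measurable_uncurry
  refine ⟨hm.aestronglyMeasurable, ?_⟩
  rw [HasFiniteIntegral, lintegral_prod _ hm.enorm.aemeasurable]
  calc ∫⁻ u in Set.Ioc s t, ∫⁻ ω, ‖g (Y u.toNNReal ω)‖ₑ ∂P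
      ≤ ∫⁻ _ in Set.Ioc s t, B :=
        setLIntegral_mono measurable_const fun u hu => hB _ (Real.toNNReal_le_toNNReal hu.2)
    _ < ⊤ := by simp [ENNReal.mul_lt_top]

end IsJumpDiffusion

end Moments

/-! ### The moment formula -/

lemma integral_mulVec {α κ ι : Type*} [Fintype κ] [Fintype ι] [MeasurableSpace α]
    {μ : Measure α} (M : Matrix κ ι ℝ) {v : α → ι → ℝ} (hv : Integrable v μ) :
    ∫ a, M *ᵥ v a ∂μ = M *ᵥ ∫ a, v a ∂μ :=
  M.mulVecLin.toContinuousLinearMap.integral_comp_comm hv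

lemma abs_monomialVec_le (k : ℕ) (x : ℝ) (i : Fin (k + 1)) :
    |monomialVec k x i| ≤ ((1 + Polynomial.X ^ 2) ^ k : ℝ[X]).eval x := by
  simpa [monomialVec] using abs_pow_le_one_add_sq_pow (i := i) (j := k) (by lia) x

lemma continuous_monomialVec (k : ℕ) : Continuous (monomialVec k) := by
  unfold monomialVec
  fun_prop

lemma measurable_monomialVec (k : ℕ) (i : Fin (k + 1)) : Measurable fun x => monomialVec k x i :=
  measurable_pi_iff.1 (continuous_monomialVec k).measurable i

namespace IsJumpDiffusion

variable {b σ : ℝ → ℝ} {ℓ : Kernel ℝ ℝ} {Ω : Type*} {mΩ : MeasurableSpace Ω} {P : Measure Ω}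
  {𝓕 : Filtration ℝ≥0 mΩ} {y : ℝ} {Y : ℝ≥0 → Ω → ℝ} {f g : ℝ → ℝ} {q : ℝ[X]} {K : ℝ} {j : ℕ}
  {s t : ℝ≥0} {A : Set Ω}

lemma abs_integral_comp_le (hY : IsJumpDiffusion b σ ℓ 𝓕 P y Y) (hg : Measurable g)
    (hgq : ∀ x, |g x| ≤ q.eval x) (ω : Ω) (hst : s ≤ t) :
    |∫ u in (0 : ℝ)..s, g (Y u.toNNReal ω)| ≤ ∫ u in (0 : ℝ)..t, q.eval (Y u.toNNReal ω) := by
  have hq0 (x : ℝ) : 0 ≤ q.eval x := (abs_nonneg _).trans (hgq x)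
  have hq (v w : ℝ) := hY.intervalIntegrable_comp (q := q) q.continuous.measurable
    (fun x => (abs_of_nonneg (hq0 x)).le) ω v w
  calc |∫ u in (0 : ℝ)..s, g (Y u.toNNReal ω)|
      ≤ ∫ u in (0 : ℝ)..s, |g (Y u.toNNReal ω)| :=
        intervalIntegral.abs_integral_le_integral_abs s.2
    _ ≤ ∫ u in (0 : ℝ)..s, q.eval (Y u.toNNReal ω) :=
        intervalIntegral.integral_mono_on s.2 (hY.intervalIntegrable_comp hg hgq ω _ _).abs
          (hq _ _) fun u _ => hgq _
    _ ≤ ∫ u in (0 : ℝ)..t, q.eval (Y u.toNNReal ω) :=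
        intervalIntegral.integral_mono_interval le_rfl s.2 (NNReal.coe_le_coe.2 hst)
          (ae_of_all _ fun _ => hq0 _) (hq _ _)

section Probability

variable [IsProbabilityMeasure P]

lemma integrable_integral_comp (hY : IsJumpDiffusion b σ ℓ 𝓕 P y Y)
    (hop : IsJumpDiffusionOperator b σ ℓ) (hpol : IsPolynomialOperator b σ ℓ)
    (hg : Measurable g) (hgq : ∀ x, |g x| ≤ q.eval x) (t : ℝ≥0) :
    Integrable (fun ω => ∫ u in (0 : ℝ)..t, g (Y u.toNNReal ω)) P := by
  simp only [intervalIntegral.integral_of_le t.coe_nonneg]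
  exact (hY.integrable_prod_comp hop hpol hg hgq 0 t).integral_prod_right

lemma integrable_prod_comp_restrict (hY : IsJumpDiffusion b σ ℓ 𝓕 P y Y)
    (hop : IsJumpDiffusionOperator b σ ℓ) (hpol : IsPolynomialOperator b σ ℓ)
    (hg : Measurable g) (hgq : ∀ x, |g x| ≤ q.eval x) (A : Set Ω) (s t : ℝ) :
    Integrable (fun p : ℝ × Ω => g (Y p.1.toNNReal p.2))
      ((volume.restrict (Set.Ioc s t)).prod (P.restrict A)) :=
  (hY.integrable_prod_comp hop hpol hg hgq s t).mono_measure
    (Measure.prod_mono le_rfl Measure.restrict_le_self)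

lemma intervalIntegrable_setIntegral_comp (hY : IsJumpDiffusion b σ ℓ 𝓕 P y Y)
    (hop : IsJumpDiffusionOperator b σ ℓ) (hpol : IsPolynomialOperator b σ ℓ)
    (hg : Measurable g) (hgq : ∀ x, |g x| ≤ q.eval x) (A : Set Ω) (s t : ℝ) :
    IntervalIntegrable (fun u : ℝ => ∫ ω in A, g (Y u.toNNReal ω) ∂P) volume s t :=
  ⟨(hY.integrable_prod_comp_restrict hop hpol hg hgq A s t).integral_prod_left,
    (hY.integrable_prod_comp_restrict hop hpol hg hgq A t s).integral_prod_left⟩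

lemma setIntegral_comp_eq_of_bounded (hY : IsJumpDiffusion b σ ℓ 𝓕 P y Y)
    (hop : IsJumpDiffusionOperator b σ ℓ) (hpol : IsPolynomialOperator b σ ℓ)
    (hf : PolyGrowth K j f) {B : ℝ} (hB : ∀ x, |f x| ≤ B) (hst : s ≤ t)
    (hA : MeasurableSet[𝓕 s] A) :
    ∫ ω in A, f (Y t ω) ∂P = ∫ ω in A, f (Y s ω) ∂P
      + ∫ u in (s : ℝ)..t, ∫ ω in A, generator b σ ℓ f (Y u.toNNReal ω) ∂P := by
  have hst' : (s : ℝ) ≤ t := hst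
  have hfm : Measurable f := hf.contDiff.continuous.measurable
  have hGm : Measurable (generator b σ ℓ f) := hpol.measurable_generator hop hfm
  obtain ⟨q, hq⟩ := hpol.exists_abs_generator_le_eval hf
  let I (v : ℝ≥0) (ω : Ω) : ℝ := ∫ u in (0 : ℝ)..v, generator b σ ℓ f (Y u.toNNReal ω)
  have hI (v : ℝ≥0) : Integrable (I v) P := hY.integrable_integral_comp hop hpol hGm hq v
  have hfint (v : ℝ≥0) : Integrable (fun ω => f (Y v ω)) P :=
    hY.integrable_comp hop hpol hfm (q := Polynomial.C B) (by simpa using hB) v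
  have hdom := (integrable_const (B + B)).add (hY.integrable_integral_comp hop hpol
    (q := q) q.continuous.measurable
    (fun x => (abs_of_nonneg ((abs_nonneg _).trans (hq x))).le) t)
  have hmart : ∫ ω in A, (f (Y t ω) - f y - I t ω) ∂P = ∫ ω in A, (f (Y s ω) - f y - I s ω) ∂P :=
    (hY.martingale_problem f hf.contDiff ⟨B, hB⟩).setIntegral_eq hst hdom
      (fun ω u hu => (abs_sub _ _).trans (add_le_add
        ((abs_sub _ _).trans (add_le_add (hB _) (hB _)))
        (hY.abs_integral_comp_le hGm hq ω hu))) hA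
  have hsplit (v : ℝ≥0) : ∫ ω in A, (f (Y v ω) - f y - I v ω) ∂P
      = ∫ ω in A, f (Y v ω) ∂P - ∫ _ in A, f y ∂P - ∫ ω in A, I v ω ∂P := by
    rw [integral_sub _ (hI v).integrableOn,
      integral_sub (hfint v).integrableOn (integrable_const _)]
    exact ((hfint v).sub (integrable_const _)).integrableOn
  have hswap : ∫ ω in A, I t ω ∂P - ∫ ω in A, I s ω ∂P
      = ∫ u in (s : ℝ)..t, ∫ ω in A, generator b σ ℓ f (Y u.toNNReal ω) ∂P := by
    rw [← integral_sub (hI t).integrableOn (hI s).integrableOn, intervalIntegral_integral_swap]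
    · exact integral_congr_ae (ae_of_all _ fun ω => intervalIntegral.integral_interval_sub_left
        (hY.intervalIntegrable_comp hGm hq ω _ _) (hY.intervalIntegrable_comp hGm hq ω _ _))
    · rw [Set.uIoc_of_le hst']
      exact hY.integrable_prod_comp_restrict hop hpol hGm hq A s t
  linarith [hsplit s, hsplit t]

section Limit

variable {ι : Type*} {l : Filter ι} [l.IsCountablyGenerated] {gs : ι → ℝ → ℝ}

lemma tendsto_setIntegral_comp (hY : IsJumpDiffusion b σ ℓ 𝓕 P y Y)
    (hop : IsJumpDiffusionOperator b σ ℓ) (hpol : IsPolynomialOperator b σ ℓ)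
    (hm : ∀ᶠ ε in l, Measurable (gs ε)) (hq : ∀ᶠ ε in l, ∀ x, |gs ε x| ≤ q.eval x)
    (hlim : ∀ x, Tendsto (fun ε => gs ε x) l (𝓝 (g x))) (A : Set Ω) (t : ℝ≥0) :
    Tendsto (fun ε => ∫ ω in A, gs ε (Y t ω) ∂P) l (𝓝 (∫ ω in A, g (Y t ω) ∂P)) := by
  obtain ⟨q', hq'⟩ := exists_abs_eval_le q
  exact tendsto_integral_filter_of_dominated_convergence (fun ω => q.eval (Y t ω))
    (hm.mono fun ε h => (h.comp (hY.measurable t)).aestronglyMeasurable)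
    (hq.mono fun ε h => ae_of_all _ fun ω => h _)
    (hY.integrable_comp hop hpol q.continuous.measurable hq' t).restrict
    (ae_of_all _ fun ω => hlim _)

lemma tendsto_integral_setIntegral_comp (hY : IsJumpDiffusion b σ ℓ 𝓕 P y Y)
    (hop : IsJumpDiffusionOperator b σ ℓ) (hpol : IsPolynomialOperator b σ ℓ)
    (hm : ∀ᶠ ε in l, Measurable (gs ε)) (hq : ∀ᶠ ε in l, ∀ x, |gs ε x| ≤ q.eval x)
    (hlim : ∀ x, Tendsto (fun ε => gs ε x) l (𝓝 (g x))) (A : Set Ω) (s t : ℝ) :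
    Tendsto (fun ε => ∫ u in s..t, ∫ ω in A, gs ε (Y u.toNNReal ω) ∂P) l
      (𝓝 (∫ u in s..t, ∫ ω in A, g (Y u.toNNReal ω) ∂P)) := by
  obtain ⟨q', hq'⟩ := exists_abs_eval_le q
  refine intervalIntegral.tendsto_integral_filter_of_dominated_convergence
    (fun u => ∫ ω in A, q.eval (Y u.toNNReal ω) ∂P) (hm.mono fun ε h => ?_)
    (hq.mono fun ε h => ae_of_all _ fun u _ => ?_) ?_
    (ae_of_all _ fun u _ => hY.tendsto_setIntegral_comp hop hpol hm hq hlim A _)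
  · exact (h.comp hY.measurable_uncurry).stronglyMeasurable.integral_prod_right'
      |>.aestronglyMeasurable
  · exact norm_integral_le_of_norm_le
      (hY.integrable_comp hop hpol q.continuous.measurable hq' _).restrict
      (ae_of_all _ fun ω => h _)
  · exact hY.intervalIntegrable_setIntegral_comp hop hpol q.continuous.measurable hq' A s t

end Limit

lemma setIntegral_comp_eq (hY : IsJumpDiffusion b σ ℓ 𝓕 P y Y)
    (hop : IsJumpDiffusionOperator b σ ℓ) (hpol : IsPolynomialOperator b σ ℓ)
    (hf : PolyGrowth K j f) (hst : s ≤ t) (hA : MeasurableSet[𝓕 s] A) :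
    ∫ ω in A, f (Y t ω) ∂P = ∫ ω in A, f (Y s ω) ∂P
      + ∫ u in (s : ℝ)..t, ∫ ω in A, generator b σ ℓ f (Y u.toNNReal ω) ∂P := by
  obtain ⟨q, hq⟩ := hpol.exists_abs_generator_le j
  let fs (ε x : ℝ) : ℝ := f (sinTrunc ε x)
  have hε : ∀ᶠ ε in 𝓝[>] (0 : ℝ), ε ∈ Set.Ioc (0 : ℝ) 1 := Ioc_mem_nhdsGT one_pos
  have hfs : ∀ᶠ ε in 𝓝[>] (0 : ℝ), PolyGrowth (2 * K) j (fs ε) :=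
    hε.mono fun ε h => hf.comp_sinTrunc h.1 h.2
  have hfsm : ∀ᶠ ε in 𝓝[>] (0 : ℝ), Measurable (fs ε) :=
    hfs.mono fun ε h => h.contDiff.continuous.measurable
  have hlim (v : ℝ≥0) : Tendsto (fun ε => ∫ ω in A, fs ε (Y v ω) ∂P) (𝓝[>] 0)
      (𝓝 (∫ ω in A, f (Y v ω) ∂P)) :=
    hY.tendsto_setIntegral_comp hop hpol hfsm
      (q := Polynomial.C (2 * K) * (1 + Polynomial.X ^ 2) ^ j)
      (hfs.mono fun ε h x => by simpa using h.abs_le x)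
      (fun x => (hf.contDiff.continuous.tendsto x).comp (tendsto_sinTrunc x)) A v
  have hlimG : Tendsto (fun ε => ∫ u in (s : ℝ)..t, ∫ ω in A,
      generator b σ ℓ (fs ε) (Y u.toNNReal ω) ∂P) (𝓝[>] 0)
      (𝓝 (∫ u in (s : ℝ)..t, ∫ ω in A, generator b σ ℓ f (Y u.toNNReal ω) ∂P)) :=
    hY.tendsto_integral_setIntegral_comp hop hpol (q := Polynomial.C (2 * K) * q)
      (hfsm.mono fun ε h => hpol.measurable_generator hop h)
      (hfs.mono fun ε h x => by simpa using hq _ _ h x)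
      (hpol.tendsto_generator_comp_sinTrunc hf) A s t
  refine tendsto_nhds_unique (hlim t) (((hlim s).add hlimG).congr' ?_)
  filter_upwards [hε, hfs] with ε h h'
  exact (hY.setIntegral_comp_eq_of_bounded hop hpol h' (hf.abs_comp_sinTrunc_le h.1) hst hA).symm

lemma integrable_monomialVec (hY : IsJumpDiffusion b σ ℓ 𝓕 P y Y)
    (hop : IsJumpDiffusionOperator b σ ℓ) (hpol : IsPolynomialOperator b σ ℓ) (k : ℕ) (t : ℝ≥0) :
    Integrable (fun ω => monomialVec k (Y t ω)) P :=
  .of_eval fun i =>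
    hY.integrable_comp hop hpol (measurable_monomialVec k i) (abs_monomialVec_le k · i) t

lemma setIntegral_monomialVec_apply (hY : IsJumpDiffusion b σ ℓ 𝓕 P y Y)
    (hop : IsJumpDiffusionOperator b σ ℓ) (hpol : IsPolynomialOperator b σ ℓ) (k : ℕ) (A : Set Ω)
    (t : ℝ≥0) (i : Fin (k + 1)) :
    (∫ ω in A, monomialVec k (Y t ω) ∂P) i = ∫ ω in A, monomialVec k (Y t ω) i ∂P :=
  eval_integral (fun i => (hY.integrable_monomialVec hop hpol k t).restrict.eval i) i

lemma intervalIntegrable_setIntegral_monomialVec (hY : IsJumpDiffusion b σ ℓ 𝓕 P y Y)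
    (hop : IsJumpDiffusionOperator b σ ℓ) (hpol : IsPolynomialOperator b σ ℓ) (k : ℕ) (A : Set Ω)
    (s t : ℝ) :
    IntervalIntegrable (fun u : ℝ => ∫ ω in A, monomialVec k (Y u.toNNReal ω) ∂P) volume s t := by
  have happly (i : Fin (k + 1)) : IntervalIntegrable
      (fun u : ℝ => (∫ ω in A, monomialVec k (Y u.toNNReal ω) ∂P) i) volume s t := by
    simp only [hY.setIntegral_monomialVec_apply hop hpol]
    exact hY.intervalIntegrable_setIntegral_comp hop hpol (measurable_monomialVec k i)
      (abs_monomialVec_le k · i) A s t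
  exact ⟨.of_eval fun i => (happly i).1, .of_eval fun i => (happly i).2⟩

lemma setIntegral_monomialVec_eq_add_integral (hY : IsJumpDiffusion b σ ℓ 𝓕 P y Y)
    (hop : IsJumpDiffusionOperator b σ ℓ) (hpol : IsPolynomialOperator b σ ℓ) (k : ℕ)
    (hst : s ≤ t) (hA : MeasurableSet[𝓕 s] A) :
    ∫ ω in A, monomialVec k (Y t ω) ∂P = ∫ ω in A, monomialVec k (Y s ω) ∂P
      + ∫ u in (s : ℝ)..t, generatorMatrix b σ ℓ k
        *ᵥ ∫ ω in A, monomialVec k (Y u.toNNReal ω) ∂P := by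
  have hint (u : ℝ≥0) := (hY.integrable_monomialVec hop hpol k u).restrict (s := A)
  let G := (generatorMatrix b σ ℓ k).mulVecLin.toContinuousLinearMap
  have hm := hY.intervalIntegrable_setIntegral_monomialVec hop hpol k A s t
  have hGm : IntervalIntegrable
      (fun u : ℝ => G (∫ ω in A, monomialVec k (Y u.toNNReal ω) ∂P)) volume s t :=
    ⟨G.integrable_comp hm.1, G.integrable_comp hm.2⟩
  ext i
  have hgen (u : ℝ) : ∫ ω in A, generator b σ ℓ (fun x => x ^ (i : ℕ)) (Y u.toNNReal ω) ∂P
      = G (∫ ω in A, monomialVec k (Y u.toNNReal ω) ∂P) i := by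
    rw [← G.integral_comp_comm (hint _), eval_integral fun i => (G.integrable_comp (hint _)).eval i]
    exact integral_congr_ae
      (ae_of_all _ fun ω => congrFun (hpol.generator_monomialVec k (Y u.toNNReal ω)) i)
  obtain ⟨K, j, hf⟩ := exists_polyGrowth_eval (Polynomial.X ^ (i : ℕ))
  simp only [Polynomial.eval_pow, Polynomial.eval_X] at hf
  have hdynkin := hY.setIntegral_comp_eq hop hpol hf hst hA
  simp only [hgen] at hdynkin
  rw [Pi.add_apply, hY.setIntegral_monomialVec_apply hop hpol,
    hY.setIntegral_monomialVec_apply hop hpol]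
  exact hdynkin.trans (congrArg _
    ((ContinuousLinearMap.proj (R := ℝ) i).intervalIntegral_comp_comm hGm))

lemma setIntegral_monomialVec_eq_exp (hY : IsJumpDiffusion b σ ℓ 𝓕 P y Y)
    (hop : IsJumpDiffusionOperator b σ ℓ) (hpol : IsPolynomialOperator b σ ℓ) (k : ℕ)
    (hst : s ≤ t) (hA : MeasurableSet[𝓕 s] A) :
    ∫ ω in A, monomialVec k (Y t ω) ∂P
      = NormedSpace.exp (((t : ℝ) - s) • generatorMatrix b σ ℓ k)
        *ᵥ ∫ ω in A, monomialVec k (Y s ω) ∂P := by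
  let m (u : ℝ) : Fin (k + 1) → ℝ := ∫ ω in A, monomialVec k (Y u.toNNReal ω) ∂P
  have hm : ∀ u ∈ Set.Icc (s : ℝ) t,
      m u = m s + ∫ v in (s : ℝ)..u, generatorMatrix b σ ℓ k *ᵥ m v := by
    intro u hu
    lift u to ℝ≥0 using s.coe_nonneg.trans hu.1
    simpa [m] using hY.setIntegral_monomialVec_eq_add_integral hop hpol k hu.1 hA
  simpa [m] using eq_exp_smul_mulVec_of_eq_add_integral _ hst
    (hY.intervalIntegrable_setIntegral_monomialVec hop hpol k A s t) hm

lemma condExp_monomialVec (hY : IsJumpDiffusion b σ ℓ 𝓕 P y Y)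
    (hop : IsJumpDiffusionOperator b σ ℓ) (hpol : IsPolynomialOperator b σ ℓ) (k : ℕ)
    (hst : s ≤ t) :
    P[fun ω => monomialVec k (Y t ω) | 𝓕 s] =ᵐ[P] fun ω =>
      NormedSpace.exp (((t : ℝ) - s) • generatorMatrix b σ ℓ k) *ᵥ monomialVec k (Y s ω) := by
  let L := (NormedSpace.exp (((t : ℝ) - s) • generatorMatrix b σ ℓ k)).mulVecLin
    |>.toContinuousLinearMap
  have hint := L.integrable_comp (hY.integrable_monomialVec hop hpol k s)
  have hmeas : StronglyMeasurable[𝓕 s] fun ω => monomialVec k (Y s ω) :=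
    (continuous_monomialVec k).comp_stronglyMeasurable (hY.adapted s)
  refine (ae_eq_condExp_of_forall_setIntegral_eq (𝓕.le s) (hY.integrable_monomialVec hop hpol k t)
    (fun A _ _ => hint.integrableOn) (fun A hA _ => ?_)
    (L.continuous.comp_stronglyMeasurable hmeas).aestronglyMeasurable).symm
  exact (integral_mulVec _ (hY.integrable_monomialVec hop hpol k s).restrict).trans
    (hY.setIntegral_monomialVec_eq_exp hop hpol k hst hA).symm

end Probability

end IsJumpDiffusion

/-! ### The correlator formula -/

lemma corrFormula_apply (n m : ℕ) (p : ℕ → ℝ[X]) (t : ℝ≥0) (s : ℕ → ℝ≥0)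
    (M : (r : ℕ) → ℝ → Matrix (Fin ((n + 1) ^ (r + 1))) (Fin ((n + 1) ^ (r + 1))) ℝ) (x : ℝ) :
    corrFormula n m p t s M x 0 0 = (M m ((s 0 : ℝ) - t) *ᵥ vecPow n m x) ⬝ᵥ
      (idKronCoeff n m (p m) *ᵥ (descProd n
        (fun j => (M j ((s (m - j) : ℝ) - s (m - j - 1)))ᵀ * idKronCoeff n j (p j)) m).col 0) := by
  rw [corrFormula, Matrix.mul_apply, Matrix.dotProduct_mulVec]
  exact Finset.sum_congr rfl fun k _ => congrArg (· * _) (coeffCol_mul_vecInv ..)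

lemma descProd_succ_col (n : ℕ)
    (F : (j : ℕ) → Matrix (Fin ((n + 1) ^ (j + 1))) (Fin ((n + 1) ^ j)) ℝ) (j : ℕ) :
    (descProd n F (j + 1)).col 0 = F j *ᵥ (descProd n F j).col 0 :=
  rfl

lemma tensorMonomials_zero_dotProduct_descProd (n : ℕ)
    (F : (j : ℕ) → Matrix (Fin ((n + 1) ^ (j + 1))) (Fin ((n + 1) ^ j)) ℝ) (x : ℝ) :
    tensorMonomials n 0 x ⬝ᵥ (descProd n F 0).col 0 = 1 := by
  have hcol : (descProd n F 0).col 0 = Pi.single 0 1 :=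
    funext fun k => Matrix.one_apply.trans (Pi.single_apply (0 : Fin ((n + 1) ^ 0)) 1 k).symm
  rw [hcol, dotProduct_single_one, tensorMonomials_zero]

namespace IsJumpDiffusion

variable {b σ : ℝ → ℝ} {ℓ : Kernel ℝ ℝ} {Ω : Type*} {mΩ : MeasurableSpace Ω} {P : Measure Ω}
  [IsProbabilityMeasure P] {𝓕 : Filtration ℝ≥0 mΩ} {y : ℝ} {Y : ℝ≥0 → Ω → ℝ} {s t : ℝ≥0} {n : ℕ}

lemma memLp_eval (hY : IsJumpDiffusion b σ ℓ 𝓕 P y Y) (hop : IsJumpDiffusionOperator b σ ℓ)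
    (hpol : IsPolynomialOperator b σ ℓ) (p : ℝ[X]) (t : ℝ≥0) {k : ℕ} (hk : k ≠ 0) :
    MemLp (fun ω => p.eval (Y t ω)) k P := by
  obtain ⟨q, hq⟩ := exists_abs_eval_le (p ^ k)
  have hint := hY.integrable_comp hop hpol (p ^ k).continuous.measurable hq t
  have hmeas : AEStronglyMeasurable (fun ω => p.eval (Y t ω)) P :=
    (p.continuous.measurable.comp (hY.measurable t)).aestronglyMeasurable
  rw [← integrable_norm_rpow_iff hmeas (Nat.cast_ne_zero.2 hk)
    (ENNReal.natCast_ne_top k)]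
  simpa using hint.norm

lemma integrable_prod_eval (hY : IsJumpDiffusion b σ ℓ 𝓕 P y Y)
    (hop : IsJumpDiffusionOperator b σ ℓ) (hpol : IsPolynomialOperator b σ ℓ) {ι : Type*}
    (S : Finset ι) (p : ι → ℝ[X]) (u : ι → ℝ≥0) :
    Integrable (fun ω => ∏ i ∈ S, (p i).eval (Y (u i) ω)) P := by
  obtain rfl | hS := S.eq_empty_or_nonempty
  · simp
  have hcard : (S.card : ENNReal) ≠ 0 := Nat.cast_ne_zero.2 hS.card_ne_zero
  have h := MemLp.prod' (s := S) fun i _ =>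
    hY.memLp_eval hop hpol (p i) (u i) hS.card_ne_zero
  rw [← memLp_one_iff_integrable]
  simpa [ENNReal.mul_inv_cancel hcard] using h

lemma condExp_tensorMonomials (hY : IsJumpDiffusion b σ ℓ 𝓕 P y Y)
    (hop : IsJumpDiffusionOperator b σ ℓ) (hpol : IsPolynomialOperator b σ ℓ) (n r : ℕ)
    (hst : s ≤ t) (c : Fin ((n + 1) ^ (r + 1)) → ℝ) :
    P[fun ω => tensorMonomials n (r + 1) (Y t ω) ⬝ᵥ c | 𝓕 s] =ᵐ[P] fun ω =>
      (dupExpElim b σ ℓ n r ((t : ℝ) - s) *ᵥ tensorMonomials n (r + 1) (Y s ω)) ⬝ᵥ c := by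
  let L : (Fin (n * (r + 1) + 1) → ℝ) →L[ℝ] ℝ :=
    (((dotProductBilin ℝ ℝ).flip c) ∘ₗ (dupMatrix n r).mulVecLin).toContinuousLinearMap
  have hL (u : ℝ≥0) : (fun ω => tensorMonomials n (r + 1) (Y u ω) ⬝ᵥ c)
      = L ∘ fun ω => monomialVec (n * (r + 1)) (Y u ω) :=
    funext fun ω => congrArg (· ⬝ᵥ c) (dupMatrix_mulVec n r (Y u ω)).symm
  rw [hL]
  filter_upwards [L.comp_condExp_comm (m := 𝓕 s) (hY.integrable_monomialVec hop hpol _ t),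
    hY.condExp_monomialVec hop hpol (n * (r + 1)) hst] with ω hω hω'
  rw [← hω, Function.comp_apply, hω', dupExpElim_mulVec_tensorMonomials]
  rfl

lemma condExp_eval_mul (hY : IsJumpDiffusion b σ ℓ 𝓕 P y Y)
    (hop : IsJumpDiffusionOperator b σ ℓ) (hpol : IsPolynomialOperator b σ ℓ) (r : ℕ)
    (hst : s ≤ t) {p : ℝ[X]} (hp : p.natDegree ≤ n) {Z : Ω → ℝ} (hZ : Integrable Z P)
    (hpZ : Integrable (fun ω => p.eval (Y t ω) * Z ω) P) {c : Fin ((n + 1) ^ r) → ℝ}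
    (hc : P[Z | 𝓕 t] =ᵐ[P] fun ω => tensorMonomials n r (Y t ω) ⬝ᵥ c) :
    P[fun ω => p.eval (Y t ω) * Z ω | 𝓕 s] =ᵐ[P] fun ω =>
      (dupExpElim b σ ℓ n r ((t : ℝ) - s) *ᵥ tensorMonomials n (r + 1) (Y s ω))
        ⬝ᵥ (idKronCoeff n r p *ᵥ c) := by
  have hmeas : StronglyMeasurable[𝓕 t] fun ω => p.eval (Y t ω) :=
    p.continuous.comp_stronglyMeasurable (hY.adapted t)
  have hcond : P[fun ω => p.eval (Y t ω) * Z ω | 𝓕 t] =ᵐ[P]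
      fun ω => tensorMonomials n (r + 1) (Y t ω) ⬝ᵥ (idKronCoeff n r p *ᵥ c) := by
    filter_upwards [condExp_mul_of_stronglyMeasurable_left hmeas hpZ hZ, hc] with ω hω hω'
    rw [Matrix.dotProduct_mulVec, tensorMonomials_vecMul_idKronCoeff r hp, smul_dotProduct, ← hω',
      smul_eq_mul]
    exact hω
  calc P[fun ω => p.eval (Y t ω) * Z ω | 𝓕 s]
      =ᵐ[P] P[P[fun ω => p.eval (Y t ω) * Z ω | 𝓕 t] | 𝓕 s] :=
        (condExp_condExp_of_le (𝓕.mono hst) (𝓕.le t)).symm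
    _ =ᵐ[P] P[fun ω => tensorMonomials n (r + 1) (Y t ω) ⬝ᵥ (idKronCoeff n r p *ᵥ c) | 𝓕 s] :=
        condExp_congr_ae hcond
    _ =ᵐ[P] _ := hY.condExp_tensorMonomials hop hpol n r hst _

section Correlator

variable {M : (r : ℕ) → ℝ → Matrix (Fin ((n + 1) ^ (r + 1))) (Fin ((n + 1) ^ (r + 1))) ℝ}

lemma condExp_prod_range (hY : IsJumpDiffusion b σ ℓ 𝓕 P y Y)
    (hop : IsJumpDiffusionOperator b σ ℓ) (hpol : IsPolynomialOperator b σ ℓ)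
    (hM : ∀ r τ x, M r τ *ᵥ vecPow n r x = dupExpElim b σ ℓ n r τ *ᵥ vecPow n r x)
    {p : ℕ → ℝ[X]} {u : ℕ → ℝ≥0} {j : ℕ} (hp : ∀ i < j, (p i).natDegree ≤ n)
    (hu : ∀ i < j, u (i + 1) ≤ u i) :
    P[fun ω => ∏ i ∈ Finset.range j, (p i).eval (Y (u i) ω) | 𝓕 (u j)] =ᵐ[P] fun ω =>
      tensorMonomials n j (Y (u j) ω) ⬝ᵥ (descProd n
        (fun i => (M i ((u i : ℝ) - u (i + 1)))ᵀ * idKronCoeff n i (p i)) j).col 0 := by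
  induction j with
  | zero =>
    simp only [Finset.prod_range_zero, tensorMonomials_zero_dotProduct_descProd]
    rw [condExp_const (𝓕.le _)]
  | succ j ih =>
    have hprod (k : ℕ) := hY.integrable_prod_eval hop hpol (Finset.range k) p u
    have hsucc := hprod (j + 1)
    simp only [Finset.prod_range_succ_comm] at hsucc ⊢
    refine (hY.condExp_eval_mul hop hpol j (hu j j.lt_succ_self) (hp j j.lt_succ_self) (hprod j)
      hsucc (ih (fun i hi => hp i (by lia)) fun i hi => hu i (by lia))).trans
      (ae_of_all _ fun ω => ?_)
    simp only [descProd_succ_col, ← vecPow_eq_tensorMonomials, ← hM]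
    rw [← Matrix.mulVec_mulVec, Matrix.dotProduct_mulVec _ (M j _)ᵀ, Matrix.vecMul_transpose]

/-- Only the action of `M^{(r)}(τ)` on `vec (X_n^{(r)}(x))` enters, so this covers both
`e^{G̃^{(r)}τ}` and `D e^{Gτ} E`. -/
lemma condExp_prod_eq_corrFormula (hY : IsJumpDiffusion b σ ℓ 𝓕 P y Y)
    (hop : IsJumpDiffusionOperator b σ ℓ) (hpol : IsPolynomialOperator b σ ℓ)
    (hM : ∀ r τ x, M r τ *ᵥ vecPow n r x = dupExpElim b σ ℓ n r τ *ᵥ vecPow n r x)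
    {m : ℕ} {p : ℕ → ℝ[X]} (hp : ∀ k ≤ m, (p k).natDegree ≤ n) {s : ℕ → ℝ≥0} (hts : t ≤ s 0)
    (hs : ∀ k < m, s k ≤ s (k + 1)) :
    P[fun ω => ∏ k ∈ Finset.range (m + 1), (p (m - k)).eval (Y (s k) ω) | 𝓕 t]
      =ᵐ[P] fun ω => corrFormula n m p t s M (Y t ω) 0 0 := by
  let u (i : ℕ) : ℝ≥0 := s (m - i)
  have hu : ∀ i < m, u (i + 1) ≤ u i := fun i hi => by
    simpa [u, show m - (i + 1) + 1 = m - i by lia] using hs (m - (i + 1)) (by lia)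
  have hum : u m = s 0 := by simp [u]
  let Z (j : ℕ) (ω : Ω) : ℝ := ∏ i ∈ Finset.range j, (p i).eval (Y (u i) ω)
  have hZ (j : ℕ) : Integrable (Z j) P := hY.integrable_prod_eval hop hpol _ p u
  have hZsucc : Z (m + 1) = fun ω => (p m).eval (Y (u m) ω) * Z m ω :=
    funext fun ω => Finset.prod_range_succ_comm _ _
  have hreflect : (fun ω => ∏ k ∈ Finset.range (m + 1), (p (m - k)).eval (Y (s k) ω))
      = Z (m + 1) := by
    ext ω
    simp only [Z]
    rw [← Finset.prod_range_reflect]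
    refine Finset.prod_congr rfl fun i hi => ?_
    have := Finset.mem_range_succ_iff.1 hi
    simp [u, show m - (m - i) = i by lia]
  have hstep := hY.condExp_eval_mul hop hpol m (hts.trans_eq hum.symm) (hp m le_rfl) (hZ m)
    (hZsucc ▸ hZ (m + 1))
    (hY.condExp_prod_range hop hpol hM (fun i hi => hp i hi.le) hu)
  rw [hreflect, hZsucc]
  refine hstep.trans (ae_of_all _ fun ω => ?_)
  simp only [corrFormula_apply, hM]
  rw [vecPow_eq_tensorMonomials, hum]
  rfl

end Correlator

end IsJumpDiffusion

end

end PolyCorr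

theorem theorem4p5 {Ω : Type*} {mΩ : MeasurableSpace Ω} (P : Measure Ω) [IsProbabilityMeasure P]
    (𝓕 : Filtration ℝ≥0 mΩ) (b σ : ℝ → ℝ) (ℓ : Kernel ℝ ℝ)
    (hop : IsJumpDiffusionOperator b σ ℓ) (hpol : IsPolynomialOperator b σ ℓ)
    (y : ℝ) (Y : ℝ≥0 → Ω → ℝ) (hY : IsJumpDiffusion b σ ℓ 𝓕 P y Y)
    (m n : ℕ) (p : ℕ → ℝ[X]) (hp : ∀ k ≤ m, (p k).natDegree ≤ n)
    (t : ℝ≥0) (s : ℕ → ℝ≥0) (hts : t < s 0) (hs : ∀ k < m, s k < s (k + 1)) :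
    -- the generator matrices exist
    (∀ k, IsGeneratorMatrix b σ ℓ k (generatorMatrix b σ ℓ k))
    -- the product is integrable, and its conditional expectation is given by the formula
    ∧ Integrable (fun ω => ∏ k ∈ Finset.range (m + 1), (p (m - k)).eval (Y (s k) ω)) P
    ∧ P[fun ω => ∏ k ∈ Finset.range (m + 1), (p (m - k)).eval (Y (s k) ω) | 𝓕 t]
        =ᵐ[P] (fun ω => corrFormula n m p t s (corrExp b σ ℓ n) (Y t ω) 0 0)
    -- the formula remains valid with `D e^{Gτ} E` in place of every `e^{G̃τ}`
    ∧ P[fun ω => ∏ k ∈ Finset.range (m + 1), (p (m - k)).eval (Y (s k) ω) | 𝓕 t]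
        =ᵐ[P] (fun ω => corrFormula n m p t s (dupExpElim b σ ℓ n) (Y t ω) 0 0)
    -- `e^{G̃τ} = D e^{Gτ} E` as operators on `vec (X_n^{(r)}(x))`
    ∧ (∀ r : ℕ, ∀ τ x : ℝ,
        corrExp b σ ℓ n r τ *ᵥ vecPow n r x = dupExpElim b σ ℓ n r τ *ᵥ vecPow n r x)
    -- the corresponding identity of matrices
    ∧ (∀ r : ℕ, ∀ τ : ℝ,
        corrExp b σ ℓ n r τ = dupExpElim b σ ℓ n r τ + (1 - dupMatrix n r * elimMatrix n r))
    -- `G̃_n^{(0)} = G_n`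
    ∧ corrGenerator b σ ℓ n 0
        = mcast (by simp) (by simp) (generatorMatrix b σ ℓ n) := by
  have hM := corrExp_mulVec_vecPow b σ ℓ n
  have hs' : ∀ k < m, s k ≤ s (k + 1) := fun k hk => (hs k hk).le
  exact ⟨hpol.isGeneratorMatrix,
    hY.integrable_prod_eval hop hpol _ (fun k => p (m - k)) s,
    hY.condExp_prod_eq_corrFormula hop hpol hM hp hts.le hs',
    hY.condExp_prod_eq_corrFormula hop hpol (fun _ _ _ => rfl) hp hts.le hs',
    hM, corrExp_eq b σ ℓ n, corrGenerator_zero b σ ℓ n⟩
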